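/- Let $T$ be a first-order theory (in a language of any cardinality), and let $\mathbb{O}$ be a monster model of $T$: for some uncountable cardinal $\kappa$, it is $\kappa$-saturated and strongly $\kappa$-homogeneous. Let $A \subseteq \mathbb{O}$ be a small set, i.e. $|A|<\kappa$. Variables and parameters $x, y, b, c,\dots$ denote finite tuples, and a global type is a complete type over $\mathbb{O}$. **The comb tree property.** The class of right-combs in $2^{<\omega}$ is the smallest class of sets that contains all sets of cardinality at most $1$ and contains $X \subseteq 2^{<\omega}$ whenever there is a $\sigma \in 2^{<\omega}$ such that every element of $X$ properly extends $\sigma$, exactly one element of $X$ extends $\sigma\frown 0$, and $\{\tau \in X : \tau \text{ extends } \sigma \frown 1\}$ is a right-comb. $T$ has CTP if for some $k<\omega$ there are a formula $\varphi(x,y)$ and a tree $(b_\sigma)_{\sigma \in 2^{<\omega}}$ of parameters in a model of $T$ such that for every path $\alpha \in 2^\omega$ the family $(\varphi(x,b_{\alpha\restriction n}))_{n<\omega}$ is $k$-inconsistent (any $k$ members with distinct indices are jointly inconsistent), while for every right-comb $X$ the set $\{\varphi(x,b_\sigma):\sigma\in X\}$ is consistent. $T$ is NCTP if it does not have CTP.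 **Invariance.** A global type is $A$-invariant if it is fixed by every automorphism of $\mathbb{O}$ fixing $A$ pointwise. $A$ is an invariance base if every type over $A$ extends to a global $A$-invariant type. A global type $p(x)$ is extendibly $A$-invariant if for every $q(x,y) \in S(A)$ extending $p\restriction A$, the set $p(x)\cup q(x,y)$ extends to a global $A$-invariant type. **Kim-dividing and Kim-forking.** A Morley sequence over $A$ generated by a global type $p(y)$ is a sequence $(e_i)_{i<\omega}$ in $\mathbb{O}$ such that $e_i$ realizes the restriction of $p$ to $A\cup\{e_j : j<i\}$ for every $i$. A formula $\varphi(x,b)$ Kim-divides over $A$ with regards to extendibly invariant types if there are an extendibly $A$-invariant global type $p(y)$ extending $\operatorname{tp}(b/A)$ and a Morley sequence $(e_i)_{i<\omega}$ over $A$ generated by $p$ such that $\{\varphi(x,e_i): i<\omega\}$ is inconsistent. It Kim-forks over $A$ with regards to extendibly invariant types if there are $n<\omega$ and formulas $\psi_0(x,c_0),\dots,\psi_{n-1}(x,c_{n-1})$ with $\varphi(x,b)\vdash\bigvee_{i<n}\psi_i(x,c_i)$ such that each $\psi_i(x,c_i)$ Kim-divides over $A$ with regards to extendibly invariant types. **Statement.**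 Suppose that $T$ is NCTP and that $A$ is an invariance base. Then for every formula $\varphi(x,y)$ and every tuple $b$ in $\mathbb{O}$, the formula $\varphi(x,b)$ Kim-forks over $A$ with regards to extendibly invariant types if and only if it Kim-divides over $A$ with regards to extendibly invariant types. -/

import Mathlib

open FirstOrder FirstOrder.Language Cardinal

universe u v w

namespace KimForking

variable {L : FirstOrder.Language.{u, v}}

section Types

/-- `Contains p φ` says that the formula `φ(x)`, with parameters from `C` and variables `x`
indexed by `α`, belongs to the complete type `p(x)`. A formula with parameters is an `L`-formula
whose free variables from `C` stand for the parameters. -/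
def Contains {C : Type*} {Θ : L[[C]].Theory} {α : Type*} (p : Θ.CompleteType α)
    (φ : L.Formula (C ⊕ α)) : Prop :=
  Formula.equivSentence (BoundedFormula.constantsVarsEquiv.symm φ : L[[C]].Formula α) ∈ p

variable (L) {M : Type w} [L.Structure M]

/-- `S_α(A)`: the complete types over the set of parameters `A ⊆ M` in variables indexed by `α`. -/
abbrev TypeOver (A : Set M) (α : Type) := (L[[A]].completeTheory M).CompleteType α

variable (M) in
/-- `S_α(M)`: the complete types over the whole structure; if `M` is the monster model these are
the global types. -/
abbrev GlobalType (α : Type) := (L.elementaryDiagram M).CompleteType α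

/-- `tp(b/A)`. -/
def tp [Nonempty M] {α : Type} (b : α → M) (A : Set M) : TypeOver L A α :=
  (L[[A]].completeTheory M).typeOf b

variable {L}

/-- The restriction of the global type `p` to the set of parameters `A` is `q`. -/
def Extends {α : Type} {A : Set M} (p : GlobalType L M α) (q : TypeOver L A α) : Prop :=
  ∀ φ : L.Formula (A ⊕ α), Contains q φ → Contains p (φ.relabel (Sum.map (↑) id))

/-- `v ⊨ p ↾ B`. -/
def RealizesOver {α : Type} (B : Set M) (p : GlobalType L M α) (v : α → M) : Prop :=
  ∀ φ : L.Formula (B ⊕ α), Contains p (φ.relabel (Sum.map (↑) id)) →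
    φ.Realize (Sum.elim (↑) v)

/-- The global type `p` is `Aut(M/A)`-invariant. -/
def IsInvariant {α : Type} (A : Set M) (p : GlobalType L M α) : Prop :=
  ∀ σ : M ≃[L] M, (∀ a ∈ A, σ a = a) →
    ∀ φ : L.Formula (M ⊕ α), Contains p φ ↔ Contains p (φ.relabel (Sum.map σ id))

/-- The global type `p(x)` is extendibly `A`-invariant: for every `q(x,y) ∈ S(A)` extending
`p ↾ A`, the set `p(x) ∪ q(x,y)` extends to a global `A`-invariant type `r(x,y)`. -/
def IsExtendiblyInvariant {α : Type} (A : Set M) (p : GlobalType L M α) : Prop :=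
  ∀ (n : ℕ) (q : TypeOver L A (α ⊕ Fin n)),
    (∀ φ : L.Formula (A ⊕ α), Contains p (φ.relabel (Sum.map (↑) id)) →
      Contains q (φ.relabel (Sum.map id Sum.inl))) →
    ∃ r : GlobalType L M (α ⊕ Fin n), IsInvariant A r ∧
      (∀ φ : L.Formula (M ⊕ α), Contains p φ → Contains r (φ.relabel (Sum.map id Sum.inl))) ∧
      Extends r q

variable (L) in
/-- `A` is an invariance base: every type over `A` extends to a global `A`-invariant type. -/
def IsInvarianceBase (A : Set M) : Prop :=
  ∀ (n : ℕ) (q : TypeOver L A (Fin n)),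
    ∃ p : GlobalType L M (Fin n), IsInvariant A p ∧ Extends p q

variable (L M) in
/-- `M` is a monster model of degree of saturation `κ`: it is `κ`-saturated and strongly
`κ`-homogeneous, with `κ` uncountable. Sets of parameters of size less than `κ` are small. -/
structure IsMonster [Nonempty M] (κ : Cardinal.{w}) : Prop where
  uncountable : ℵ₀ < κ
  saturated : ∀ A : Set M, #A < κ → ∀ q : TypeOver L A (Fin 1), ∃ a : Fin 1 → M, tp L a A = q
  homogeneous : ∀ (A : Set M) (f : A → M), #A < κ →
    (∀ φ : L.Formula A, φ.Realize ((↑) : A → M) ↔ φ.Realize f) →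
    ∃ σ : M ≃[L] M, ∀ a : A, σ a = f a

end Types

section Consistency

variable {M : Type w} [L.Structure M] {α β : Type} {ι : Type}

/-- The family of formulas `{φ(x, b_i) : i ∈ S}` is consistent, i.e. finitely satisfiable. -/
def IsConsistent (φ : L.Formula (α ⊕ β)) (b : ι → β → M) (S : Set ι) : Prop :=
  ∀ s : Finset ι, (s : Set ι) ⊆ S → ∃ a : α → M, ∀ i ∈ s, φ.Realize (Sum.elim a (b i))

/-- The family of formulas `(φ(x, b_i))_i` is `k`-inconsistent: any `k` members with distinct
indices are inconsistent. -/
def IsKInconsistent (k : ℕ) (φ : L.Formula (α ⊕ β)) (b : ι → β → M) : Prop :=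
  ∀ s : Finset ι, s.card = k → ¬ IsConsistent φ b (s : Set ι)

end Consistency

section KimDividing

variable {M : Type w} [L.Structure M] {α β : Type}

/-- `(e_i)_{i < ω}` is a Morley sequence over `A` generated by `p`: `e_i ⊨ p ↾ A e_{<i}`. -/
def IsMorleySequence (A : Set M) (p : GlobalType L M β) (e : ℕ → β → M) : Prop :=
  ∀ i, RealizesOver (A ∪ ⋃ j < i, Set.range (e j)) p (e i)

/-- `φ(x,y)` `p`-Kim-divides over `A`: `{φ(x, e_i) : i < ω}` is inconsistent for a Morley sequence
`(e_i)_{i < ω}` over `A` generated by `p(y)`. -/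
def KimDividesAlong (A : Set M) (p : GlobalType L M β) (φ : L.Formula (α ⊕ β)) : Prop :=
  ∃ e : ℕ → β → M, IsMorleySequence A p e ∧ ¬ IsConsistent φ e Set.univ

/-- `φ(x,b)` Kim-divides over `A` with regards to extendibly invariant types. -/
def KimDivides [Nonempty M] (A : Set M) (φ : L.Formula (α ⊕ β)) (b : β → M) : Prop :=
  ∃ p : GlobalType L M β, IsExtendiblyInvariant A p ∧ Extends p (tp L b A) ∧ KimDividesAlong A p φ

/-- `φ(x,b)` Kim-forks over `A` with regards to extendibly invariant types: it implies a finite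
disjunction of formulas, each of which Kim-divides over `A` with regards to such types. -/
def KimForks [Nonempty M] (A : Set M) (φ : L.Formula (α ⊕ β)) (b : β → M) : Prop :=
  ∃ (n : ℕ) (m : Fin n → ℕ) (ψ : ∀ i, L.Formula (α ⊕ Fin (m i))) (c : ∀ i, Fin (m i) → M),
    (∀ a : α → M, φ.Realize (Sum.elim a b) → ∃ i, (ψ i).Realize (Sum.elim a (c i))) ∧
    ∀ i, KimDivides A (ψ i) (c i)

end KimDividing

section CTP

/-- The right-combs in the tree `2^{<ω}` of finite binary sequences. -/
inductive IsRightComb : Set (List Bool) → Prop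
  | subsingleton (X : Set (List Bool)) : X.Subsingleton → IsRightComb X
  | step (X : Set (List Bool)) (σ : List Bool) :
      (∀ τ ∈ X, σ <+: τ ∧ τ ≠ σ) →
      (∃ τ, X ∩ {ρ | σ ++ [false] <+: ρ} = {τ}) →
      IsRightComb (X ∩ {ρ | σ ++ [true] <+: ρ}) →
      IsRightComb X

/-- The theory `T` has `k`-CTP. -/
def HasKCTP (k : ℕ) (T : L.Theory) : Prop :=
  ∃ (M : Theory.ModelType.{u, v, max u v} T) (l m : ℕ) (φ : L.Formula (Fin l ⊕ Fin m)) (b : List Bool → Fin m → M),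
    (∀ α : ℕ → Bool, IsKInconsistent k φ fun n => b ((List.range n).map α)) ∧
    ∀ X : Set (List Bool), IsRightComb X → IsConsistent φ b X

/-- The theory `T` has the comb tree property. -/
def HasCTP (T : L.Theory) : Prop :=
  ∃ k : ℕ, HasKCTP k T

end CTP

end KimForking

/-! The extendibly `A`-invariant extensions of `tp(c/A)` are exactly the types of `c` inside
`A`-invariant types of a copy of the whole monster model over `A`. Such a type is coded by an
ultrafilter `R` on `M → M`, with `typeAt R c` its type at `c`. The set `invExt L A` of these `R` is
compact, is preserved by precomposition with automorphisms over `A`, and is nonempty because `A` is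
an invariance base. Extendibility costs nothing afterwards: every part of a tuple has an extendibly
invariant type.

The core is `exists_universal`: for each `c` some `R` is such that on every good list of conjugates
of `c`, a single `R'` in `invExt L A` gives all entries the type `typeAt R c`. If there were none,
compactness would yield finitely many sets, one of which contains every type at `c`, each
unattainable on all of some good list. A Ramsey-type colouring argument
(`exists_finset_forall_notMem`) uses the substitutions allowed in good lists to produce a conjugate
of `c` whose type avoids all these sets, a contradiction.

Suppose now that `ψ` Kim-divides along `typeAt Rp c`, but not along the universal `typeAt Rq c`.
Finite trees are grown from a right subtree, a left copy of it placed generically over it, and a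
root realizing `typeAt Rp c` over both. The tree remains a good list, so by universality the left
copy can be chosen with all its nodes realizing `typeAt Rq c` over the right one. Paths are then
Morley for `Rp`, hence `k`-inconsistent, and right-combs are Morley for `Rq`, hence consistent. This
is CTP.

Thus under NCTP a universal `R` for the tuple gathering `b` and all parameters of the forking
disjunction witnesses Kim-dividing of every disjunct. By the pigeonhole principle it also witnesses
Kim-dividing of `φ(x,b)`. -/

namespace KimForking

variable {L : FirstOrder.Language.{u, v}}

/-! ### Complete types as limits of tuples along ultrafilters -/

section TypesAndUltrafilters

theorem realize_iExs_relabel_inr {L' : FirstOrder.Language} {α : Type*} [Finite α] {K : Type*}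
    [L'.Structure K] (χ : L'.Formula α) :
    K ⊨ (Formula.iExs α (χ.relabel (Sum.inr : α → Empty ⊕ α)) : L'.Sentence) ↔
      ∃ x : α → K, χ.Realize x := by
  unfold Sentence.Realize
  simp only [Formula.realize_iExs, Formula.realize_relabel]
  rfl

theorem realize_constantsVarsEquiv_symm {C : Type*} {α : Type*} {N : Type*} [L.Structure N]
    [L[[C]].Structure N] [(L.lhomWithConstants C).IsExpansionOn N]
    (v : α → N) (φ : L.Formula (C ⊕ α)) :
    Formula.Realize (BoundedFormula.constantsVarsEquiv.symm φ : L[[C]].Formula α) v ↔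
      φ.Realize (Sum.elim (fun c => (L.con c : N)) v) := by
  have := BoundedFormula.realize_constantsVarsEquiv (M := N)
    (φ := (BoundedFormula.constantsVarsEquiv.symm φ : L[[C]].Formula α)) (v := v) (xs := default)
  rw [Equiv.apply_symm_apply] at this
  exact this.symm

theorem contains_typeOf {C : Type*} {Θ : L[[C]].Theory} {α : Type*} {N : Type*} [L.Structure N]
    [L[[C]].Structure N] [(L.lhomWithConstants C).IsExpansionOn N] [Nonempty N] [N ⊨ Θ]
    (v : α → N) (φ : L.Formula (C ⊕ α)) :
    Contains (Θ.typeOf v) φ ↔ φ.Realize (Sum.elim (fun c => (L.con c : N)) v) := by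
  unfold Contains
  rw [Theory.CompleteType.formula_mem_typeOf, realize_constantsVarsEquiv_symm]

variable {M : Type w} [L.Structure M]

/-- Łoś's theorem: an ultrafilter on tuples determines a complete type. -/
theorem exists_type_of_ultrafilter [Nonempty M] {C : Type*} {α : Type*} [L[[C]].Structure M]
    [(L.lhomWithConstants C).IsExpansionOn M] (U : Ultrafilter (α → M)) :
    ∃ p : (L[[C]].completeTheory M).CompleteType α, ∀ φ : L.Formula (C ⊕ α),
      Contains p φ ↔ {v | φ.Realize (Sum.elim (fun c => (L.con c : M)) v)} ∈ U := by
  let N := (U : Filter (α → M)).Product fun _ => M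
  have hmod : N ⊨ L[[C]].completeTheory M := by
    refine ⟨fun φ hφ => ?_⟩
    rw [Ultraproduct.sentence_realize]
    exact Filter.Eventually.of_forall fun _ => hφ
  let x : α → (α → M) → M := fun i v => v i
  let y : α → N := fun i =>
    (Quotient.mk _ (x i) : Quotient (Filter.productSetoid (U : Filter (α → M)) _))
  refine ⟨(L[[C]].completeTheory M).typeOf y, fun φ => ?_⟩
  unfold Contains
  rw [Theory.CompleteType.formula_mem_typeOf]
  refine (Ultraproduct.realize_formula_cast _ x).trans ?_
  exact Filter.eventually_congr
    (Filter.Eventually.of_forall fun v => realize_constantsVarsEquiv_symm v φ)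

/-- Every complete type over a structure is the limit of tuples along an ultrafilter. -/
theorem exists_ultrafilter_of_type {C : Type*} {α : Type*} [Finite α] [L[[C]].Structure M]
    [(L.lhomWithConstants C).IsExpansionOn M]
    (p : (L[[C]].completeTheory M).CompleteType α) :
    ∃ U : Ultrafilter (α → M), ∀ φ : L.Formula (C ⊕ α),
      Contains p φ ↔ {v | φ.Realize (Sum.elim (fun c => (L.con c : M)) v)} ∈ U := by
  classical
  let D : L[[C]].Formula α → Set (α → M) := fun φ => {v | φ.Realize v}
  obtain ⟨N, v, rfl⟩ := Theory.exists_modelType_is_realized_in _ p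
  obtain ⟨U, hU⟩ := Ultrafilter.exists_ultrafilter_of_finite_inter_nonempty
    (D '' {φ | φ.Realize v}) (by
      intro S hS
      choose f hf hDf using fun s : S => hS s.2
      let χ : L[[C]].Formula α := Formula.iInf f
      have hχ : χ.Realize v := by
        rw [Formula.realize_iInf]
        exact hf
      have hM : M ⊨ (Formula.iExs α (χ.relabel (Sum.inr : α → Empty ⊕ α)) : L[[C]].Sentence) := by
        by_contra hne
        rw [← Sentence.realize_not, ← mem_completeTheory] at hne
        have := Theory.realize_sentence_of_mem (M := N) _ hne
        rw [Sentence.realize_not] at this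
        exact this ((realize_iExs_relabel_inr χ).2 ⟨v, hχ⟩)
      obtain ⟨x, hx⟩ := (realize_iExs_relabel_inr χ).1 hM
      rw [Formula.realize_iInf] at hx
      refine ⟨x, fun s hs => ?_⟩
      have hs' : x ∈ D (f ⟨s, hs⟩) := hx ⟨s, hs⟩
      rwa [hDf] at hs')
  refine ⟨U, fun φ => ?_⟩
  unfold Contains
  rw [Theory.CompleteType.formula_mem_typeOf]
  have hD : ∀ φ : L.Formula (C ⊕ α), {v | φ.Realize (Sum.elim (fun c => (L.con c : M)) v)} =
      D (BoundedFormula.constantsVarsEquiv.symm φ) := fun φ => by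
    ext y
    exact (realize_constantsVarsEquiv_symm y φ).symm
  rw [hD]
  refine ⟨fun h => hU ⟨_, h, rfl⟩, fun h => ?_⟩
  by_contra hn
  have h2 : (D (BoundedFormula.constantsVarsEquiv.symm φ))ᶜ ∈ U :=
    hU ⟨Formula.not (BoundedFormula.constantsVarsEquiv.symm φ), by
      simpa [Formula.realize_not] using hn, by ext y; simp [D, Formula.realize_not]⟩
  exact (Ultrafilter.compl_mem_iff_notMem.1 h2) h

end TypesAndUltrafilters

/-! ### Definable sets and automorphisms over a set -/

section Definability

variable {M : Type w} [L.Structure M]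

theorem definable_univ_iff {α : Type*} {s : Set (α → M)} :
    (Set.univ : Set M).Definable L s ↔
      ∃ φ : L.Formula (M ⊕ α), s = {v | φ.Realize (Sum.elim id v)} := by
  rw [Set.definable_iff_exists_formula_sum]
  constructor
  · rintro ⟨φ, rfl⟩
    refine ⟨φ.relabel (Sum.map (↑) id), ?_⟩
    ext v
    simp [Formula.realize_relabel, Sum.elim_comp_map]
  · rintro ⟨φ, rfl⟩
    refine ⟨φ.relabel (Sum.map (fun a => ⟨a, trivial⟩) id), ?_⟩
    ext v
    simp only [Set.mem_ofPred_eq, Formula.realize_relabel, Sum.elim_comp_map]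
    rfl

theorem definable_setOf_elim {α β : Type*} {B : Set M} {s : Set (α ⊕ β → M)}
    (hs : B.Definable L s) (v : α → M) :
    (B ∪ Set.range v).Definable L {a : β → M | Sum.elim v a ∈ s} := by
  rw [Set.definable_iff_exists_formula_sum] at hs ⊢
  obtain ⟨φ, rfl⟩ := hs
  refine ⟨φ.relabel (Sum.elim (fun b : B => Sum.inl ⟨b, Or.inl b.2⟩)
    (Sum.elim (fun i => Sum.inl ⟨v i, Or.inr ⟨i, rfl⟩⟩) Sum.inr)), ?_⟩
  ext a
  simp only [Set.mem_ofPred_eq, Formula.realize_relabel]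
  refine iff_of_eq (congrArg _ ?_)
  ext (b | i | j) <;> rfl

variable (L) in
/-- The group of automorphisms of `M` that fix `B` pointwise. -/
def autFixing (B : Set M) : Subgroup (Equiv.Perm M) where
  carrier := {g | (∃ σ : M ≃[L] M, ⇑σ = g) ∧ ∀ b ∈ B, g b = b}
  one_mem' := ⟨⟨FirstOrder.Language.Equiv.refl L M, rfl⟩, fun _ _ => rfl⟩
  mul_mem' := by
    rintro g h ⟨⟨σ, hσ⟩, hg⟩ ⟨⟨τ, hτ⟩, hh⟩
    refine ⟨⟨σ.comp τ, ?_⟩, fun b hb => ?_⟩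
    · ext x
      simp [← hσ, ← hτ]
    · rw [Equiv.Perm.mul_apply, hh b hb, hg b hb]
  inv_mem' := by
    rintro g ⟨⟨σ, hσ⟩, hg⟩
    refine ⟨⟨σ.symm, ?_⟩, fun b hb => ?_⟩
    · ext x
      rw [Equiv.Perm.eq_inv_iff_eq, ← hσ, σ.apply_symm_apply]
    · rw [Equiv.Perm.inv_eq_iff_eq, hg b hb]

theorem realize_comp_of_mem_autFixing {B : Set M} {g : Equiv.Perm M} (hg : g ∈ autFixing L B)
    {α : Type*} (φ : L.Formula α) (v : α → M) : φ.Realize (g ∘ v) ↔ φ.Realize v := by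
  obtain ⟨⟨σ, hσ⟩, -⟩ := hg
  rw [← hσ]
  exact StrongHomClass.realize_formula σ φ

theorem autFixing_mono {B C : Set M} (h : B ⊆ C) : autFixing L C ≤ autFixing L B :=
  fun _ hg => ⟨hg.1, fun b hb => hg.2 b (h hb)⟩

theorem comp_mem_iff {B : Set M} {g : Equiv.Perm M} (hg : g ∈ autFixing L B) {α : Type*}
    {s : Set (α → M)} (hs : B.Definable L s) {v : α → M} : g ∘ v ∈ s ↔ v ∈ s := by
  obtain ⟨φ, rfl⟩ := Set.definable_iff_exists_formula_sum.1 hs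
  simp only [Set.mem_ofPred_eq]
  rw [← realize_comp_of_mem_autFixing hg φ (Sum.elim _ v), Sum.comp_elim]
  refine iff_of_eq (congrArg (fun f => φ.Realize (Sum.elim f _)) ?_)
  ext b
  exact (hg.2 b b.2).symm

theorem definable_preimage_comp_autFixing {B C : Set M} {g : Equiv.Perm M}
    (hg : g ∈ autFixing L C) {α : Type*} {s : Set (α → M)} (hs : B.Definable L s) :
    (g ⁻¹' B).Definable L {v | g ∘ v ∈ s} := by
  rw [Set.definable_iff_exists_formula_sum] at hs ⊢
  obtain ⟨φ, rfl⟩ := hs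
  refine ⟨φ.relabel (Sum.map (fun b : B => (⟨g⁻¹ b, by simp⟩ : ↥(g ⁻¹' B))) id), ?_⟩
  ext v
  simp only [Set.mem_ofPred_eq, Formula.realize_relabel, Sum.elim_comp_map]
  convert realize_comp_of_mem_autFixing hg φ (Sum.elim (fun b : B => g⁻¹ b) v) using 2
  · rw [Sum.comp_elim]
    congr 1
    ext b
    exact (g.apply_symm_apply _).symm
  · rfl

end Definability

/-! ### Homogeneity and saturation for finite tuples -/

section Monster

variable {M : Type w} [L.Structure M] [Nonempty M] {κ : Cardinal.{w}}

theorem IsMonster.mk_union_lt (hM : IsMonster L M κ) {B F : Set M} (hB : #B < κ)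
    (hF : F.Finite) : #(B ∪ F : Set M) < κ :=
  (mk_union_le B F).trans_lt
    (add_lt_of_lt hM.uncountable.le hB (hF.lt_aleph0.trans hM.uncountable))

theorem IsMonster.exists_autFixing (hM : IsMonster L M κ) {B : Set M} (hB : #B < κ)
    {ι : Type*} [Finite ι] {c c' : ι → M}
    (h : ∀ s : Set (ι → M), B.Definable L s → c ∈ s → c' ∈ s) :
    ∃ g ∈ autFixing L B, g ∘ c = c' := by
  classical
  -- A point may be both in `B` and in `c`. Indexing it by `B` makes the automorphism fix `B`
  -- visibly.
  have hr : ∀ x : ↥(B ∪ Set.range c), ∃ y : B ⊕ ι, Sum.elim (↑) c y = (x : M) ∧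
      ∀ hx : (x : M) ∈ B, y = Sum.inl ⟨x, hx⟩ := by
    rintro ⟨x, hx⟩
    by_cases hxB : x ∈ B
    · exact ⟨Sum.inl ⟨x, hxB⟩, rfl, fun _ => rfl⟩
    · obtain ⟨i, rfl⟩ := hx.resolve_left hxB
      exact ⟨Sum.inr i, rfl, fun h => absurd h hxB⟩
  choose r hr hrB using hr
  have h' : ∀ φ : L.Formula (B ⊕ ι), φ.Realize (Sum.elim (↑) c) ↔ φ.Realize (Sum.elim (↑) c') := by
    have key : ∀ φ : L.Formula (B ⊕ ι), φ.Realize (Sum.elim (↑) c) →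
        φ.Realize (Sum.elim (↑) c') := fun φ =>
      h {v | φ.Realize (Sum.elim (fun b : B => (b : M)) v)}
        (Set.definable_iff_exists_formula_sum.2 ⟨φ, rfl⟩)
    refine fun φ => ⟨key φ, fun hφ => ?_⟩
    by_contra hn
    exact Formula.realize_not.1 (key φ.not (Formula.realize_not.2 hn)) hφ
  obtain ⟨σ, hσ⟩ := hM.homogeneous (B ∪ Set.range c) (fun x => Sum.elim (↑) c' (r x))
    (hM.mk_union_lt hB (Set.finite_range c)) (fun φ => by
      have := h' (φ.relabel r)
      rw [Formula.realize_relabel, Formula.realize_relabel] at this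
      convert this using 2
      · ext x
        exact (hr x).symm
      · rfl)
  refine ⟨σ.toEquiv, ⟨⟨σ, rfl⟩, fun b hb => ?_⟩, ?_⟩
  · have := hσ ⟨b, Or.inl hb⟩
    rw [hrB _ hb] at this
    exact this
  · ext i
    have h1 : σ (c i) = Sum.elim (↑) c' (r ⟨c i, Or.inr ⟨i, rfl⟩⟩) := hσ ⟨c i, Or.inr ⟨i, rfl⟩⟩
    -- The index chosen for `c i` need not be `i`, but the equality of the two coordinates is part
    -- of the type and so passes to `c'`.
    have h2 := (h' ((Term.var (r ⟨c i, Or.inr ⟨i, rfl⟩⟩)).equal (Term.var (Sum.inr i)))).1 (by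
      simp only [Formula.realize_equal, Term.realize_var, hr]
      rfl)
    simp only [Formula.realize_equal, Term.realize_var] at h2
    exact h1.trans h2

theorem contains_tp {α : Type} {B : Set M} (a : α → M) (φ : L.Formula (B ⊕ α)) :
    Contains (tp L a B) φ ↔ φ.Realize (Sum.elim (↑) a) :=
  contains_typeOf a φ

/-- Saturation is assumed for one variable only. Induction on the length realizes the first
coordinates, then the last one over them. -/
theorem IsMonster.exists_realization (hM : IsMonster L M κ) {ι : Type} [Finite ι]
    (U : Ultrafilter (ι → M)) {B : Set M} (hB : #B < κ) :
    ∃ v : ι → M, ∀ s, B.Definable L s → s ∈ U → v ∈ s := by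
  suffices H : ∀ (n : ℕ) (U : Ultrafilter (Fin n → M)) (B : Set M), #B < κ →
      ∃ v : Fin n → M, ∀ s, B.Definable L s → s ∈ U → v ∈ s by
    obtain ⟨n, ⟨e⟩⟩ := Finite.exists_equiv_fin ι
    obtain ⟨v, hv⟩ := H n (U.map (fun f => f ∘ e.symm)) B hB
    refine ⟨v ∘ e, fun s hs hU => hv ((fun f => f ∘ e) ⁻¹' s) (hs.preimage_comp e) ?_⟩
    rw [Ultrafilter.mem_map]
    convert hU
    ext f
    simp [Function.comp_assoc]
  have one : ∀ (U : Ultrafilter (Fin 1 → M)) (B : Set M), #B < κ →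
      ∃ v : Fin 1 → M, ∀ s, B.Definable L s → s ∈ U → v ∈ s := by
    intro U B hB
    obtain ⟨q, hq⟩ := exists_type_of_ultrafilter (L := L) (C := B) U
    obtain ⟨a, rfl⟩ := hM.saturated B hB q
    refine ⟨a, fun s hs hU => ?_⟩
    obtain ⟨φ, rfl⟩ := Set.definable_iff_exists_formula_sum.1 hs
    exact (contains_tp a φ).1 ((hq φ).2 hU)
  intro n
  induction n with
  | zero =>
    intro U B hB
    refine ⟨default, fun s _ hU => ?_⟩
    obtain ⟨x, hx⟩ := U.nonempty_of_mem hU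
    rwa [Subsingleton.elim default x]
  | succ n ih =>
    intro U B hB
    let e : Fin n ⊕ Fin 1 ≃ Fin (n + 1) := finSumFinEquiv
    obtain ⟨v, hv⟩ := ih (U.map fun f => f ∘ e ∘ Sum.inl) B hB
    let S : Set (Set (Fin n ⊕ Fin 1 → M)) := {s | B.Definable L s ∧ {f | f ∘ e ∈ s} ∈ U}
    -- The fibres over `v` of the sets in `U` have the finite intersection property: projections of
    -- `B`-definable sets are `B`-definable, and `v` lies in every such projection.
    obtain ⟨W, hW⟩ := Ultrafilter.exists_ultrafilter_of_finite_inter_nonempty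
      ((fun s => {a : Fin 1 → M | Sum.elim v a ∈ s}) '' S) (by
        classical
        intro Y hY
        choose f hf hfY using fun y : Y => hY y.2
        have h1 : B.Definable L (⋂ y, f y) := Set.definable_iInter_of_finite fun y => (hf y).1
        have h2 := hv _ h1.exists_of_finite (by
          have : ⋂ y, {g : Fin (n+1) → M | g ∘ e ∈ f y} ∈ U := by
            exact Filter.iInter_mem.2 fun y => (hf y).2
          rw [Ultrafilter.mem_map]
          refine Filter.mem_of_superset this fun g hg => ?_
          refine ⟨g ∘ e ∘ Sum.inr, ?_⟩
          rw [Set.mem_iInter] at hg ⊢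
          intro y
          have h3 : Sum.elim (g ∘ e ∘ Sum.inl) (g ∘ e ∘ Sum.inr) = g ∘ e := by
            ext (i | i) <;> rfl
          change Sum.elim (g ∘ e ∘ Sum.inl) (g ∘ e ∘ Sum.inr) ∈ f y
          rw [h3]
          exact hg y)
        obtain ⟨a, ha⟩ := h2
        refine ⟨a, fun y hy => ?_⟩
        have := Set.mem_iInter.1 ha ⟨y, hy⟩
        have h3 : a ∈ (fun s => {a : Fin 1 → M | Sum.elim v a ∈ s}) (f ⟨y, hy⟩) := this
        rwa [hfY] at h3)
    obtain ⟨a, ha⟩ := one W (B ∪ Set.range v) (hM.mk_union_lt hB (Set.finite_range v))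
    refine ⟨Sum.elim v a ∘ e.symm, fun s hs hU => ?_⟩
    refine ha _ (definable_setOf_elim (hs.preimage_comp e.symm) v)
      (hW ⟨_, ⟨hs.preimage_comp e.symm, ?_⟩, rfl⟩)
    convert hU
    ext f
    simp [Function.comp_assoc]

end Monster

/-! ### Global types in ultrafilter form -/

section Represents

variable {M : Type w} [L.Structure M]

/-- The ultrafilter `U` on tuples converges to the global type `p`. -/
def Represents {α : Type} (U : Ultrafilter (α → M)) (p : GlobalType L M α) : Prop :=
  ∀ φ : L.Formula (M ⊕ α), Contains p φ ↔ {v | φ.Realize (Sum.elim id v)} ∈ U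

theorem exists_represents {α : Type} [Finite α] (p : GlobalType L M α) :
    ∃ U, Represents U p :=
  exists_ultrafilter_of_type (C := M) p

theorem exists_represented [Nonempty M] {α : Type} (U : Ultrafilter (α → M)) :
    ∃ p : GlobalType L M α, Represents U p :=
  exists_type_of_ultrafilter (C := M) U

variable {α : Type} {U : Ultrafilter (α → M)} {p : GlobalType L M α}

theorem Represents.contains_relabel {A : Set M} (h : Represents U p) (φ : L.Formula (A ⊕ α)) :
    Contains p (φ.relabel (Sum.map (↑) id)) ↔ {v | φ.Realize (Sum.elim (↑) v)} ∈ U := by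
  rw [h]
  simp only [Formula.realize_relabel, Sum.elim_comp_map]
  rfl

theorem Represents.isInvariant_iff {A : Set M} (h : Represents U p) :
    IsInvariant A p ↔ ∀ g ∈ autFixing L A, ∀ s : Set (α → M), (Set.univ : Set M).Definable L s →
      s ∈ U → {v | g ∘ v ∈ s} ∈ U := by
  have key : ∀ (σ : M ≃[L] M) (φ : L.Formula (M ⊕ α)),
      Contains p (φ.relabel (Sum.map σ id)) ↔
        {v | σ.symm ∘ v ∈ {v | φ.Realize (Sum.elim id v)}} ∈ U := by
    intro σ φ
    rw [h]
    refine iff_of_eq (congrArg (· ∈ U) ?_)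
    ext v
    simp only [Formula.realize_relabel, Sum.elim_comp_map, Set.mem_ofPred_eq]
    rw [← StrongHomClass.realize_formula σ φ (v := Sum.elim id (σ.symm ∘ v)), Sum.comp_elim,
      ← Function.comp_assoc]
    have : ⇑σ ∘ ⇑σ.symm = id := funext σ.apply_symm_apply
    rw [this]
    rfl
  constructor
  · rintro hp g ⟨⟨σ, hσ⟩, hg⟩ s hs hU
    obtain ⟨φ, rfl⟩ := definable_univ_iff.1 hs
    have := (hp σ.symm (fun a ha => ?_) φ).1 ((h φ).2 hU)
    · rw [key] at this
      rw [← hσ]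
      exact this
    · rw [← hg a ha, ← hσ, σ.symm_apply_apply, hσ, hg a ha]
  · intro hU
    have one : ∀ (σ : M ≃[L] M), (∀ a ∈ A, σ a = a) → ∀ φ : L.Formula (M ⊕ α), Contains p φ →
        Contains p (φ.relabel (Sum.map σ id)) := by
      intro σ hσ φ hφ
      rw [key]
      have hmem : σ.toEquiv ∈ autFixing L A := ⟨⟨σ, rfl⟩, hσ⟩
      exact hU _ (inv_mem hmem) _ (definable_univ_iff.2 ⟨φ, rfl⟩) ((h φ).1 hφ)
    refine fun σ hσ φ => ⟨one σ hσ φ, fun hφ => ?_⟩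
    have := one σ.symm (fun a ha => by rw [← hσ a ha, σ.symm_apply_apply, hσ a ha]) _ hφ
    rw [h] at this ⊢
    simp only [Formula.realize_relabel, Sum.elim_comp_map] at this
    have e : (id ∘ ⇑σ.symm) ∘ ⇑σ = id := funext σ.symm_apply_apply
    rw [e] at this
    exact this

theorem Represents.extends_tp_iff [Nonempty M] {A : Set M} (h : Represents U p) (d : α → M) :
    Extends p (tp L d A) ↔ ∀ s : Set (α → M), A.Definable L s → d ∈ s → s ∈ U := by
  unfold Extends
  simp only [contains_tp, h.contains_relabel]
  constructor
  · intro H s hs hd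
    obtain ⟨φ, rfl⟩ := Set.definable_iff_exists_formula_sum.1 hs
    exact H φ hd
  · exact fun H φ hφ => H _ (Set.definable_iff_exists_formula_sum.2 ⟨φ, rfl⟩) hφ

theorem Represents.realizesOver_iff {B : Set M} (h : Represents U p) (v : α → M) :
    RealizesOver B p v ↔ ∀ s : Set (α → M), B.Definable L s → s ∈ U → v ∈ s := by
  unfold RealizesOver
  simp only [h.contains_relabel]
  constructor
  · intro H s hs hd
    obtain ⟨φ, rfl⟩ := Set.definable_iff_exists_formula_sum.1 hs
    exact H φ hd
  · exact fun H φ hφ => H _ (Set.definable_iff_exists_formula_sum.2 ⟨φ, rfl⟩) hφ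

end Represents

/-! ### Invariant types of a copy of the monster model -/

section InvariantExtensions

variable {M : Type w} [L.Structure M]

/-- The type of `f ∘ e`, where `f` is a generic copy of `M` with respect to `R`. -/
def typeAt {ι : Type*} (R : Ultrafilter (M → M)) (e : ι → M) : Ultrafilter (ι → M) :=
  R.map fun f => f ∘ e

theorem mem_typeAt {ι : Type*} {R : Ultrafilter (M → M)} {e : ι → M} {s : Set (ι → M)} :
    s ∈ typeAt R e ↔ {f | f ∘ e ∈ s} ∈ R := Iff.rfl

variable (L) in
/-- Global types of a copy of `M`, restricted to tuples from `F`, that extend the type of the copied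
tuple over `A` and are invariant under the automorphisms that fix `A`. -/
def invExtOn (A F : Set M) : Set (Ultrafilter (M → M)) :=
  {R | ∀ (n : ℕ) (e : Fin n → M), (∀ i, e i ∈ F) →
    (∀ s : Set (Fin n → M), A.Definable L s → e ∈ s → s ∈ typeAt R e) ∧
    ∀ g ∈ autFixing L A, ∀ s : Set (Fin n → M), (Set.univ : Set M).Definable L s →
      s ∈ typeAt R e → {v | g ∘ v ∈ s} ∈ typeAt R e}

variable (L) in
/-- The `A`-invariant global types of a copy of `M` that extend the type of `M` over `A`. -/
def invExt (A : Set M) : Set (Ultrafilter (M → M)) := invExtOn L A Set.univ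

theorem isClosed_invExtOn (A F : Set M) : IsClosed (invExtOn L A F) := by
  have h1 : ∀ (t : Set (M → M)), IsClosed {R : Ultrafilter (M → M) | t ∈ R} :=
    ultrafilter_isClosed_basic
  have h2 : ∀ (t : Set (M → M)), IsOpen {R : Ultrafilter (M → M) | t ∈ R} :=
    ultrafilter_isOpen_basic
  unfold invExtOn
  simp only [Set.ofPred_forall, Set.ofPred_and, mem_typeAt]
  refine isClosed_iInter fun n => isClosed_iInter fun e => isClosed_iInter fun he =>
    (isClosed_iInter fun s => isClosed_iInter fun _ => isClosed_iInter fun _ => h1 _).inter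
    (isClosed_iInter fun g => isClosed_iInter fun _ => isClosed_iInter fun s =>
      isClosed_iInter fun _ => ?_)
  exact isClosed_imp (h2 _) (h1 _)

theorem mem_invExt_iff {A : Set M} {R : Ultrafilter (M → M)} :
    R ∈ invExt L A ↔ ∀ F : Finset M, R ∈ invExtOn L A F := by
  classical
  constructor
  · exact fun h F n e _ => h n e fun _ => trivial
  · exact fun h n e _ => h (Finset.univ.image e) n e fun i => by simp

theorem invExtOn_antitone (A : Set M) {F F' : Set M} (h : F ⊆ F') :
    invExtOn L A F' ⊆ invExtOn L A F :=
  fun _ hR n e he => hR n e fun i => h (he i)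

/-- Compactness of the space of ultrafilters: the conditions for finite `F` define closed sets,
directed under enlarging `F`. -/
theorem exists_mem_invExt {A : Set M} (Γ : Set (Set (M → M)))
    (h : ∀ F : Finset M, ∃ R ∈ invExtOn L A (F : Set M), ∀ t ∈ Γ, t ∈ R) :
    ∃ R ∈ invExt L A, ∀ t ∈ Γ, t ∈ R := by
  classical
  have hc : ∀ F : Finset M,
      IsClosed (invExtOn L A (F : Set M) ∩ {R : Ultrafilter (M → M) | ∀ t ∈ Γ, t ∈ R}) := by
    intro F
    refine (isClosed_invExtOn A _).inter ?_
    simp only [Set.ofPred_forall]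
    exact isClosed_iInter fun t => isClosed_iInter fun _ => ultrafilter_isClosed_basic t
  obtain ⟨R, hR⟩ := IsCompact.nonempty_iInter_of_directed_nonempty_isCompact_isClosed
    (fun F : Finset M => invExtOn L A (F : Set M) ∩ {R : Ultrafilter (M → M) | ∀ t ∈ Γ, t ∈ R})
    (fun F F' => ⟨F ∪ F',
      Set.inter_subset_inter_left _ (invExtOn_antitone A (by simp)),
      Set.inter_subset_inter_left _ (invExtOn_antitone A (by simp))⟩)
    (fun F => (h F).imp fun R hR => hR) (fun F => (hc F).isCompact) hc
  rw [Set.mem_iInter] at hR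
  exact ⟨R, mem_invExt_iff.2 fun F => (hR F).1, (hR ∅).2⟩

variable {A : Set M} {R : Ultrafilter (M → M)}

theorem mem_typeAt_of_definable (hR : R ∈ invExt L A) {ι : Type*} [Finite ι] {e : ι → M}
    {s : Set (ι → M)} (hs : A.Definable L s) (he : e ∈ s) : s ∈ typeAt R e := by
  obtain ⟨n, ⟨k⟩⟩ := Finite.exists_equiv_fin ι
  have := (hR n (e ∘ k.symm) fun _ => trivial).1 _ (hs.preimage_comp k)
    (by simpa [Function.comp_assoc] using he)
  rw [mem_typeAt] at this ⊢
  simpa [Function.comp_assoc] using this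

theorem comp_mem_typeAt (hR : R ∈ invExt L A) {ι : Type*} [Finite ι] {e : ι → M}
    {s : Set (ι → M)} (hs : (Set.univ : Set M).Definable L s) {g : Equiv.Perm M}
    (hg : g ∈ autFixing L A) (h : s ∈ typeAt R e) : {v | g ∘ v ∈ s} ∈ typeAt R e := by
  obtain ⟨n, ⟨k⟩⟩ := Finite.exists_equiv_fin ι
  have := (hR n (e ∘ k.symm) fun _ => trivial).2 g hg _ (hs.preimage_comp k)
    (by rw [mem_typeAt] at h ⊢; simpa [Function.comp_assoc] using h)
  rw [mem_typeAt] at this ⊢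
  simpa [Function.comp_assoc] using this

/-- An automorphism over `A` permutes the copies of `M`. -/
def translate (R : Ultrafilter (M → M)) (g : Equiv.Perm M) : Ultrafilter (M → M) :=
  R.map fun f => f ∘ g

theorem mem_typeAt_translate {g : Equiv.Perm M} {ι : Type*} {e : ι → M} {s : Set (ι → M)} :
    s ∈ typeAt (translate R g) e ↔ s ∈ typeAt R (g ∘ e) := Iff.rfl

theorem translate_mem_invExt (hR : R ∈ invExt L A) {g : Equiv.Perm M} (hg : g ∈ autFixing L A) :
    translate R g ∈ invExt L A := by
  refine fun n e _ => ⟨fun s hs he => ?_, fun k hk s hs h => ?_⟩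
  · rw [mem_typeAt_translate]
    exact mem_typeAt_of_definable hR hs ((comp_mem_iff hg hs).2 he)
  · rw [mem_typeAt_translate] at h ⊢
    exact comp_mem_typeAt hR hs hk h

/-- A type of the tuple `d` becomes a type of a copy of `M` by sending each entry of `d` to the
matching coordinate. Other points are sent to themselves, an arbitrary value that tuples from the
range of `d` never see. -/
theorem map_mem_invExtOn {α : Type} [Finite α] {U : Ultrafilter (α → M)} {d : α → M}
    (hU : ∀ s : Set (α → M), A.Definable L s → d ∈ s → s ∈ U)
    (hinv : ∀ g ∈ autFixing L A, ∀ s : Set (α → M), (Set.univ : Set M).Definable L s →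
      s ∈ U → {v | g ∘ v ∈ s} ∈ U) {idx : M → Option α}
    (hidx : ∀ m ∈ Set.range d, (idx m).map d = some m) :
    U.map (fun v m => (idx m).elim m v) ∈ invExtOn L A (Set.range d) := by
  intro n e he
  have : ∀ i, ∃ j, idx (e i) = some j ∧ d j = e i := fun i => by
    simpa using hidx _ (he i)
  choose j hj hdj using this
  have hmem : ∀ s : Set (Fin n → M), s ∈ typeAt (U.map (fun v m => (idx m).elim m v)) e ↔
      {v | v ∘ j ∈ s} ∈ U := by
    intro s
    rw [mem_typeAt, Ultrafilter.mem_map]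
    refine iff_of_eq (congrArg (· ∈ U) ?_)
    ext v
    refine iff_of_eq (congrArg (· ∈ s) ?_)
    ext i
    simp [hj]
  simp only [hmem]
  refine ⟨fun s hs h => hU _ (hs.preimage_comp j) ?_, fun g hg s hs h =>
    hinv g hg _ (hs.preimage_comp j) h⟩
  rw [Set.mem_ofPred_eq, show d ∘ j = e from funext hdj]
  exact h

theorem exists_index {α : Type} (d : α → M) :
    ∃ idx : M → Option α, ∀ m ∈ Set.range d, (idx m).map d = some m := by
  classical
  refine ⟨fun m => if h : ∃ i, d i = m then some h.choose else none, ?_⟩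
  rintro m hm
  have hm' : ∃ i, d i = m := hm
  simp only [hm', dif_pos, Option.map_some]
  exact congrArg some hm'.choose_spec

end InvariantExtensions

/-! ### Extendible invariance as restriction from a copy of the monster model -/

section Existence

variable {M : Type w} [L.Structure M] [Nonempty M] {A : Set M}

theorem IsInvarianceBase.invExt_nonempty (hA : IsInvarianceBase L A) : (invExt L A).Nonempty := by
  obtain ⟨R, hR, -⟩ := exists_mem_invExt (L := L) (A := A) ∅ (by
    intro F
    obtain ⟨n, d, hd⟩ : ∃ (n : ℕ) (d : Fin n → M), Set.range d = F :=
      ⟨F.card, (↑) ∘ F.equivFin.symm, by rw [EquivLike.range_comp]; simp⟩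
    obtain ⟨p, hp, hext⟩ := hA n (tp L d A)
    obtain ⟨U, hU⟩ := exists_represents p
    obtain ⟨idx, hidx⟩ := exists_index d
    rw [← hd]
    exact ⟨_, map_mem_invExtOn ((hU.extends_tp_iff d).1 hext) (hU.isInvariant_iff.1 hp) hidx,
      fun _ h => h.elim⟩)
  exact ⟨R, hR⟩

/-- For a finite set enumerated by `d`, extendibility applied to `tp(cd/A)` gives an invariant type
of `cd` containing `p`. Compactness glues these. -/
theorem IsExtendiblyInvariant.exists_mem_invExt {α : Type} [Finite α] {c : α → M}
    {p : GlobalType L M α} (hp : IsExtendiblyInvariant A p) (hpc : Extends p (tp L c A)) :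
    ∃ R ∈ invExt L A, Represents (typeAt R c) p := by
  classical
  obtain ⟨R, hR, hΓ⟩ := KimForking.exists_mem_invExt (L := L) (A := A)
    {t | ∃ φ : L.Formula (M ⊕ α), Contains p φ ∧ t = {f | φ.Realize (Sum.elim id (f ∘ c))}} (by
    intro F
    obtain ⟨n, d, hd⟩ : ∃ (n : ℕ) (d : Fin n → M), Set.range d = F :=
      ⟨F.card, (↑) ∘ F.equivFin.symm, by rw [EquivLike.range_comp]; simp⟩
    obtain ⟨V, hV⟩ := exists_represents p
    obtain ⟨r, hr, hpr, hext⟩ := hp n (tp L (Sum.elim c d) A) (fun φ hφ => by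
      rw [contains_tp, Formula.realize_relabel, Sum.elim_comp_map]
      by_contra hn
      have := hpc φ.not (by rw [contains_tp]; exact hn)
      rw [hV.contains_relabel] at this hφ
      obtain ⟨v, hv1, hv2⟩ := V.nonempty_of_mem (Filter.inter_mem this hφ)
      exact hv1 hv2)
    obtain ⟨U, hU⟩ := exists_represents r
    obtain ⟨idx, hidx⟩ := exists_index (Sum.elim c d)
    have h1 := (hU.extends_tp_iff _).1 hext
    refine ⟨_, invExtOn_antitone A (F' := Set.range (Sum.elim c d)) (by rw [← hd]; simp)
      (map_mem_invExtOn h1 (hU.isInvariant_iff.1 hr) hidx), ?_⟩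
    rintro t ⟨φ, hφ, rfl⟩
    rw [Ultrafilter.mem_map]
    have h2 := (hU _).1 (hpr φ hφ)
    have h3 : ∀ i, ∃ j, idx (c i) = some j ∧ Sum.elim c d j = c i := fun i => by
      simpa only [Option.map_eq_some_iff] using hidx (c i) ⟨Sum.inl i, rfl⟩
    choose j hj hdj using h3
    -- `idx` may name an entry of `c` by another coordinate of `(c, d)` with the same value. That
    -- coincidence is `A`-definable, so it holds almost everywhere.
    have h4 := h1 {v | v ∘ j = v ∘ Sum.inl} ?_ (funext hdj)
    · filter_upwards [h2, h4] with v hv hv'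
      simp only [Formula.realize_relabel, Sum.elim_comp_map] at hv hv'
      simp only [Set.mem_preimage, Set.mem_ofPred_eq]
      have hj' : ((fun m => (idx m).elim m v) ∘ c : α → M) = v ∘ Sum.inl := by
        rw [← hv']
        ext i
        simp [hj]
      rw [hj']
      exact hv
    · refine Set.definable_iff_exists_formula_sum.2
        ⟨Formula.iInf fun i => (Term.var (Sum.inr (j i))).equal (Term.var (Sum.inr (Sum.inl i))), ?_⟩
      ext v
      simp [Formula.realize_iInf, Formula.realize_equal, funext_iff])
  refine ⟨R, hR, fun φ => ⟨fun h => hΓ _ ⟨φ, h, rfl⟩, fun h => ?_⟩⟩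
  by_contra hn
  obtain ⟨V, hV⟩ := exists_represents p
  have hnot : Contains p φ.not := by
    rw [hV] at hn ⊢
    exact Ultrafilter.compl_mem_iff_notMem.2 hn
  obtain ⟨f, hf1, hf2⟩ := R.nonempty_of_mem (Filter.inter_mem (hΓ _ ⟨_, hnot, rfl⟩) h)
  exact hf1 hf2

variable {κ : Cardinal.{w}}

/-- Saturation and homogeneity realize `q` by a tuple starting with `c`. The type under `R` of this
longer tuple is then the required extension. -/
theorem isExtendiblyInvariant_of_represents (hM : IsMonster L M κ) (hA : #A < κ)
    {R : Ultrafilter (M → M)} (hR : R ∈ invExt L A) {α : Type} [Finite α] {c : α → M}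
    {p : GlobalType L M α} (hp : Represents (typeAt R c) p) : IsExtendiblyInvariant A p := by
  intro n q hq
  obtain ⟨V, hV⟩ := exists_ultrafilter_of_type (L := L) (C := A) q
  obtain ⟨v, hv⟩ := hM.exists_realization V hA
  obtain ⟨g, hg, hgc⟩ := hM.exists_autFixing hA (c := c) (c' := v ∘ Sum.inl) (by
    intro s hs hcs
    refine hv _ (hs.preimage_comp Sum.inl) ?_
    have := mem_typeAt_of_definable hR hs hcs
    obtain ⟨φ, rfl⟩ := Set.definable_iff_exists_formula_sum.1 hs
    have := (hV _).1 (hq φ ((hp.contains_relabel φ).2 this))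
    simp only [Formula.realize_relabel, Sum.elim_comp_map] at this
    exact this)
  have he : g ∘ Sum.elim c (⇑g⁻¹ ∘ v ∘ Sum.inr) = v := by
    ext (i | i)
    · exact congrFun hgc i
    · simp
  obtain ⟨r, hr⟩ := exists_represented (L := L) (typeAt R (Sum.elim c (⇑g⁻¹ ∘ v ∘ Sum.inr)))
  refine ⟨r, hr.isInvariant_iff.2 fun k hk s hs h => comp_mem_typeAt hR hs hk h, fun φ hφ => ?_,
    fun φ hφ => ?_⟩
  · rw [hr]
    rw [hp] at hφ
    simp only [Formula.realize_relabel, Sum.elim_comp_map]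
    exact hφ
  · rw [hr.contains_relabel]
    refine mem_typeAt_of_definable hR (Set.definable_iff_exists_formula_sum.2 ⟨φ, rfl⟩) ?_
    rw [← comp_mem_iff hg (Set.definable_iff_exists_formula_sum.2 ⟨φ, rfl⟩), he]
    exact hv _ (Set.definable_iff_exists_formula_sum.2 ⟨φ, rfl⟩) ((hV φ).1 hφ)

theorem extends_of_represents {R : Ultrafilter (M → M)} (hR : R ∈ invExt L A) {α : Type} [Finite α]
    {c : α → M} {p : GlobalType L M α} (hp : Represents (typeAt R c) p) : Extends p (tp L c A) :=
  (hp.extends_tp_iff c).2 fun _ hs hc => mem_typeAt_of_definable hR hs hc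

end Existence

/-! ### Generic automorphic copies of finite sets -/

section Realizes

variable {M : Type w} [L.Structure M] {ι : Type*}

variable (L) in
/-- `v` realizes the restriction to `B` of the global type given by `U`. -/
def Realizes (U : Ultrafilter (ι → M)) (B : Set M) (v : ι → M) : Prop :=
  ∀ s : Set (ι → M), B.Definable L s → s ∈ U → v ∈ s

theorem Realizes.mono {U : Ultrafilter (ι → M)} {B C : Set M} {v : ι → M}
    (h : Realizes L U C v) (hBC : B ⊆ C) : Realizes L U B v :=
  fun s hs => h s (hs.mono hBC)

theorem Realizes.mem_of_mem {U : Ultrafilter (ι → M)} {B : Set M} {v : ι → M}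
    (h : Realizes L U B v) {s : Set (ι → M)} (hs : B.Definable L s) (hv : v ∈ s) : s ∈ U := by
  by_contra hn
  exact h _ hs.compl (Ultrafilter.compl_mem_iff_notMem.2 hn) hv

theorem Realizes.smul {A B : Set M} {R : Ultrafilter (M → M)} (hR : R ∈ invExt L A) [Finite ι]
    {c v : ι → M} (h : Realizes L (typeAt R c) B v) {g : Equiv.Perm M} (hg : g ∈ autFixing L A) :
    Realizes L (typeAt R c) (g '' B) (g • v) := by
  intro s hs hU
  have := definable_preimage_comp_autFixing hg hs
  rw [Set.preimage_image_eq _ g.injective] at this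
  exact h _ this (comp_mem_typeAt hR (hs.mono (Set.subset_univ _)) hg hU)

theorem Realizes.comp_right {B : Set M} {R : Ultrafilter (M → M)} {c v : ι → M}
    (h : Realizes L (typeAt R c) B v) {ι' : Type*} (j : ι' → ι) :
    Realizes L (typeAt R (c ∘ j)) B (v ∘ j) :=
  fun _ hs hU => h _ (hs.preimage_comp j) hU

theorem image_eq_of_mem_autFixing {A : Set M} {g : Equiv.Perm M} (hg : g ∈ autFixing L A) :
    g '' A = A :=
  (Set.image_congr fun a ha => hg.2 a ha).trans (Set.image_id' _)

variable {κ : Cardinal.{w}}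

theorem Realizes.exists_smul_eq [Nonempty M] (hM : IsMonster L M κ) [Finite ι] {B : Set M}
    (hB : #B < κ) {U : Ultrafilter (ι → M)} {v v' : ι → M} (h : Realizes L U B v) (h' : Realizes L U B v') :
    ∃ g ∈ autFixing L B, g • v = v' :=
  hM.exists_autFixing hB fun s hs hv => h' s hs (h.mem_of_mem hs hv)

variable (L) in
/-- `g` realizes the restriction of `R` to `B` on all tuples from `F`. -/
def IsGeneric (R : Ultrafilter (M → M)) (B F : Set M) (g : Equiv.Perm M) : Prop :=
  ∀ (n : ℕ) (e : Fin n → M), (∀ i, e i ∈ F) → Realizes L (typeAt R e) B (g • e)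

theorem IsGeneric.mono {R : Ultrafilter (M → M)} {B C F : Set M} {g : Equiv.Perm M}
    (h : IsGeneric L R C F g) (hBC : B ⊆ C) : IsGeneric L R B F g :=
  fun n e he => (h n e he).mono hBC

theorem IsGeneric.realizes [Finite ι] {R : Ultrafilter (M → M)} {B F : Set M} {g : Equiv.Perm M}
    (h : IsGeneric L R B F g) {e : ι → M} (he : ∀ i, e i ∈ F) :
    Realizes L (typeAt R e) B (g • e) := by
  obtain ⟨n, ⟨k⟩⟩ := Finite.exists_equiv_fin ι
  have := (h n (e ∘ k.symm) fun i => he _).comp_right k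
  rw [Function.comp_assoc, k.symm_comp_self, Function.comp_id] at this
  convert this
  ext i
  simp

variable {A : Set M} {R : Ultrafilter (M → M)}

theorem IsGeneric.mul (hR : R ∈ invExt L A) {B F : Set M} {g h : Equiv.Perm M}
    (hg : IsGeneric L R B F g) (hh : h ∈ autFixing L A) : IsGeneric L R (h '' B) F (h * g) :=
  fun n e he => by
    rw [mul_smul]
    exact (hg n e he).smul hR hh

theorem exists_enumeration (F : Finset M) : ∃ (n : ℕ) (d : Fin n → M), Set.range d = F :=
  ⟨F.card, (↑) ∘ F.equivFin.symm, by rw [EquivLike.range_comp]; simp⟩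

theorem exists_isGeneric [Nonempty M] (hM : IsMonster L M κ) (hA : #A < κ) (hR : R ∈ invExt L A)
    {B : Set M} (hB : #B < κ) (hAB : A ⊆ B) {F : Set M} (hF : F.Finite) :
    ∃ g ∈ autFixing L A, IsGeneric L R B F g := by
  obtain ⟨n, d, hd⟩ := exists_enumeration hF.toFinset
  rw [hF.coe_toFinset] at hd
  obtain ⟨v, hv⟩ := hM.exists_realization (typeAt R d) hB
  obtain ⟨g, hg, rfl⟩ := hM.exists_autFixing hA (c := d) (c' := v) fun s hs hds =>
    hv s (hs.mono hAB) (mem_typeAt_of_definable hR hs hds)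
  refine ⟨g, hg, fun m e he => ?_⟩
  have he' : ∀ i, ∃ j, d j = e i := fun i => by
    have := he i
    rwa [← hd] at this
  choose j hj using he'
  obtain rfl : d ∘ j = e := funext hj
  exact Realizes.comp_right hv j

theorem IsGeneric.exists_eqOn [Nonempty M] (hM : IsMonster L M κ) {B : Set M} (hB : #B < κ)
    {F : Set M} (hF : F.Finite) {g g' : Equiv.Perm M} (hg : IsGeneric L R B F g)
    (hg' : IsGeneric L R B F g') : ∃ k ∈ autFixing L B, ∀ x ∈ F, k (g x) = g' x := by
  obtain ⟨n, d, hd⟩ := exists_enumeration hF.toFinset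
  rw [hF.coe_toFinset] at hd
  have hdF : ∀ i, d i ∈ F := fun i => hd ▸ ⟨i, rfl⟩
  obtain ⟨k, hk, hkd⟩ := (hg n d hdF).exists_smul_eq hM hB (hg' n d hdF)
  refine ⟨k, hk, fun x hx => ?_⟩
  rw [← hd] at hx
  obtain ⟨i, rfl⟩ := hx
  exact congrFun hkd i

end Realizes

/-! ### Good lists and the universal invariant type -/

section GoodLists

variable {M : Type w} {ι : Type*}

/-- The entries of the tuples in a list. -/
def points (l : List (ι → M)) : Set M := {x | ∃ v ∈ l, x ∈ Set.range v}

theorem finite_points [Finite ι] (l : List (ι → M)) : (points l).Finite := by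
  have : points l = ⋃ v ∈ {v | v ∈ l}, Set.range v := by
    ext x
    simp [points]
  rw [this]
  exact (List.finite_toSet l).biUnion fun v _ => Set.finite_range v

theorem mem_points {l : List (ι → M)} {v : ι → M} (hv : v ∈ l) (i : ι) : v i ∈ points l :=
  ⟨v, hv, i, rfl⟩

theorem points_subset {l l' : List (ι → M)} (h : l ⊆ l') : points l ⊆ points l' :=
  fun _ ⟨v, hv, hx⟩ => ⟨v, h hv, hx⟩

variable [L.Structure M]

variable (L) in
/-- A list of conjugates of `c` over `A` such that, for each tuple `v` in it, any finitely many
conjugates of `c` can be substituted for `v` over one common conjugate of the tuples after `v`. -/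
def Good (A : Set M) (c : ι → M) : List (ι → M) → Prop
  | [] => True
  | v :: l => Good A c l ∧ (∃ g ∈ autFixing L A, g • c = v) ∧
      ∀ U : Finset (ι → M), (∀ u ∈ U, ∃ g ∈ autFixing L A, g • c = u) →
        ∃ k ∈ autFixing L A, ∀ u ∈ U, ∃ h ∈ autFixing L A, h • v = u ∧ ∀ w ∈ l, h • w = k • w

variable {A : Set M} {c : ι → M}

theorem good_singleton {x : ι → M} (hx : ∃ g ∈ autFixing L A, g • c = x) : Good L A c [x] := by
  refine ⟨trivial, hx, fun U hU => ⟨1, one_mem _, fun u hu => ?_⟩⟩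
  obtain ⟨g, hg, rfl⟩ := hx
  obtain ⟨h, hh, rfl⟩ := hU u hu
  exact ⟨h * g⁻¹, mul_mem hh (inv_mem hg), by rw [mul_smul, inv_smul_smul], by simp⟩

theorem Good.map {l : List (ι → M)} (hl : Good L A c l) {g : Equiv.Perm M}
    (hg : g ∈ autFixing L A) : Good L A c (l.map (g • ·)) := by
  induction l with
  | nil => trivial
  | cons v l ih =>
    obtain ⟨h1, ⟨g₀, hg₀, rfl⟩, h3⟩ := hl
    refine ⟨ih h1, ⟨g * g₀, mul_mem hg hg₀, mul_smul _ _ _⟩, fun U hU => ?_⟩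
    obtain ⟨k, hk, hkU⟩ := h3 U hU
    refine ⟨k * g⁻¹, mul_mem hk (inv_mem hg), fun u hu => ?_⟩
    obtain ⟨h, hh, rfl, hw⟩ := hkU u hu
    refine ⟨h * g⁻¹, mul_mem hh (inv_mem hg), by rw [mul_smul, inv_smul_smul], ?_⟩
    simp only [List.mem_map, forall_exists_index, and_imp, forall_apply_eq_imp_iff₂, mul_smul,
      inv_smul_smul]
    exact hw

/-- To substitute the tuples of `U` for an entry of `l₁`, substitute first within `l₁`. The moved
copies of `l₂` all realize the same invariant type, so each can be moved further onto one copy `g'`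
generic over everything, with the substitution kept fixed. -/
theorem Good.append [Nonempty M] [Finite ι] {κ : Cardinal.{w}} (hM : IsMonster L M κ) (hA : #A < κ)
    {R : Ultrafilter (M → M)} (hR : R ∈ invExt L A) {l₁ l₂ : List (ι → M)} {g : Equiv.Perm M}
    (h₁ : Good L A c l₁) (h₂ : Good L A c (l₂.map (g • ·)))
    (hg : IsGeneric L R (A ∪ points l₁) (points l₂) g) :
    Good L A c (l₁ ++ l₂.map (g • ·)) := by
  induction l₁ with
  | nil => exact h₂
  | cons v l ih =>
    obtain ⟨hl, hv, hU⟩ := h₁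
    refine ⟨ih hl (hg.mono (Set.union_subset_union_right _ (points_subset (List.subset_cons_self _ _)))),
      hv,
      fun U hUc => ?_⟩
    obtain ⟨k, hk, hkU⟩ := hU U hUc
    have hfin : (points U.toList ∪ k '' points l).Finite :=
      (finite_points _).union ((finite_points _).image _)
    obtain ⟨g', -, hg'⟩ := exists_isGeneric hM hA hR (hM.mk_union_lt hA hfin)
      Set.subset_union_left (finite_points l₂)
    obtain ⟨τ, hτ, hτg⟩ := IsGeneric.exists_eqOn hM
      (hM.mk_union_lt hA ((finite_points l).image k)) (finite_points l₂)
      (((hg.mono (Set.union_subset_union_right _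
        (points_subset (List.subset_cons_self _ _)))).mul hR hk).mono
        (by rw [Set.image_union, image_eq_of_mem_autFixing hk]))
      (hg'.mono (Set.union_subset_union_right _ Set.subset_union_right))
    refine ⟨τ * k, mul_mem (autFixing_mono Set.subset_union_left hτ) hk, fun u hu => ?_⟩
    obtain ⟨h, hh, rfl, hw⟩ := hkU u hu
    -- By invariance `h * g` is generic over the right side. On the left side it can be compared
    -- with `g'`.
    have hsub : A ∪ (Set.range (h • v) ∪ k '' points l) ⊆ h '' (A ∪ points (v :: l)) := by
      rw [Set.image_union, image_eq_of_mem_autFixing hh]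
      refine Set.union_subset_union_right _ (Set.union_subset ?_ ?_)
      · rintro _ ⟨i, rfl⟩
        exact ⟨v i, mem_points (by simp) i, rfl⟩
      · rintro _ ⟨_, ⟨w, hwl, i, rfl⟩, rfl⟩
        exact ⟨w i, mem_points (by simp [hwl]) i, congrFun (hw w hwl) i⟩
    obtain ⟨τ', hτ', hτg'⟩ := IsGeneric.exists_eqOn hM
      (hM.mk_union_lt hA ((Set.finite_range (h • v)).union ((finite_points l).image k)))
      (finite_points l₂) ((hg.mul hR hh).mono hsub)
      (hg'.mono (Set.union_subset_union_right _ (Set.union_subset_union_left _ (by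
        rintro _ ⟨i, rfl⟩
        exact mem_points (by simpa using hu) i))))
    refine ⟨τ' * h, mul_mem (autFixing_mono Set.subset_union_left hτ') hh, ?_, ?_⟩
    · ext i
      exact hτ'.2 _ (Or.inr (Or.inl ⟨i, rfl⟩))
    · intro w hwl
      change w ∈ l ++ _ at hwl
      rw [List.mem_append, List.mem_map] at hwl
      rcases hwl with hwl | ⟨w, hwl, rfl⟩
      · ext i
        have h1 : k (w i) ∈ k '' points l := ⟨w i, mem_points hwl i, rfl⟩
        have h2 : h (w i) = k (w i) := congrFun (hw w hwl) i
        simp only [mul_smul, Pi.smul_apply, Equiv.Perm.smul_def]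
        rw [h2, hτ'.2 _ (Or.inr (Or.inr h1)), hτ.2 _ (Or.inr h1)]
      · ext i
        have h1 := mem_points hwl i
        exact (hτg' _ h1).trans (hτg _ h1).symm

/-- A Ramsey step. Each `R` colours the conjugates of `c` by the sets to which their types belong,
and no translate of `U` is covered by the colours of `J`. So once a copy of the tail of `l` has
colour `s`, some admissible substitute for the head has colour `s` too. -/
theorem exists_finset_of_good {s : Set (ι → M)} {J : List (Set (ι → M) × List (ι → M))}
    {U : Finset (ι → M)} (hU : ∀ u ∈ U, ∃ g ∈ autFixing L A, g • c = u)
    (hJ : ∀ R ∈ invExt L A, ∃ u ∈ U, ∀ P ∈ J, P.1 ∉ typeAt R u) {l : List (ι → M)}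
    (hl : Good L A c l) :
    ∃ (V : Finset (ι → M)) (Γ : Finset (Equiv.Perm M)),
      (∀ u ∈ V, ∃ g ∈ autFixing L A, g • c = u) ∧ (∀ g ∈ Γ, g ∈ autFixing L A) ∧
      ∀ R ∈ invExt L A, (∀ u ∈ V, s ∈ typeAt R u ∨ ∃ P ∈ J, P.1 ∈ typeAt R u) →
        ∃ g ∈ Γ, ∀ v ∈ l, s ∈ typeAt R (g • v) := by
  classical
  induction l with
  | nil => exact ⟨∅, {1}, by simp, by simp [one_mem], by simp⟩
  | cons v l ih =>
    obtain ⟨hl', hv, hsub⟩ := hl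
    obtain ⟨V, Γ, hV, hΓ, H⟩ := ih hl'
    obtain ⟨k, hk, hkU⟩ := hsub U hU
    choose! h hh hhv hhw using hkU
    refine ⟨V ∪ (Γ ×ˢ U).image (fun p => (p.1 * k⁻¹) • p.2),
      (Γ ×ˢ U).image (fun p => p.1 * k⁻¹ * h p.2), ?_, ?_, ?_⟩
    · simp only [Finset.mem_union, Finset.mem_image, Finset.mem_product, Prod.exists]
      rintro u (hu | ⟨g, u, ⟨hg, hu⟩, rfl⟩)
      · exact hV u hu
      · obtain ⟨g', hg', rfl⟩ := hU u hu
        exact ⟨g * k⁻¹ * g', mul_mem (mul_mem (hΓ g hg) (inv_mem hk)) hg', mul_smul _ _ _⟩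
    · simp only [Finset.mem_image, Finset.mem_product, Prod.exists]
      rintro _ ⟨g, u, ⟨hg, hu⟩, rfl⟩
      exact mul_mem (mul_mem (hΓ g hg) (inv_mem hk)) (hh u hu)
    · intro R hR hcol
      obtain ⟨g, hg, hgl⟩ := H R hR fun u hu => hcol u (Finset.mem_union_left _ hu)
      -- The twist by `g * k⁻¹` takes the common conjugate `k • l` of the tail to the coloured copy
      -- `g • l`.
      obtain ⟨u, hu, huJ⟩ := hJ _ (translate_mem_invExt hR (mul_mem (hΓ g hg) (inv_mem hk)))
      have hs : s ∈ typeAt R ((g * k⁻¹) • u) := by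
        refine (hcol _ (Finset.mem_union_right _
          (Finset.mem_image.2 ⟨(g, u), ?_, rfl⟩))).resolve_right ?_
        · simp [hg, hu]
        · rintro ⟨P, hP, hP'⟩
          exact huJ P hP hP'
      refine ⟨g * k⁻¹ * h u, Finset.mem_image.2 ⟨(g, u), by simp [hg, hu], rfl⟩, ?_⟩
      rintro w hw
      rw [List.mem_cons] at hw
      rcases hw with rfl | hw
      · rwa [mul_smul, hhv u hu]
      · rw [mul_smul, hhw u hu w hw, mul_smul, inv_smul_smul]
        exact hgl w hw

/-- Finitely many sets that avoid all types, each along a good list, jointly avoid all types along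
some finite set of conjugates. -/
theorem exists_finset_forall_notMem (J : List (Set (ι → M) × List (ι → M)))
    (hJ : ∀ P ∈ J, Good L A c P.2 ∧ ∀ R ∈ invExt L A, ∃ v ∈ P.2, P.1 ∉ typeAt R v) :
    ∃ U : Finset (ι → M), (∀ u ∈ U, ∃ g ∈ autFixing L A, g • c = u) ∧
      ∀ R ∈ invExt L A, ∃ u ∈ U, ∀ P ∈ J, P.1 ∉ typeAt R u := by
  induction J with
  | nil => exact ⟨{c}, by simpa using ⟨1, one_mem _, one_smul _ _⟩, by simp⟩
  | cons P J ih =>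
    obtain ⟨U, hU, hUJ⟩ := ih fun P hP => hJ P (by simp [hP])
    obtain ⟨hP, hPR⟩ := hJ P (by simp)
    obtain ⟨V, Γ, hV, hΓ, H⟩ := exists_finset_of_good (s := P.1) hU hUJ hP
    refine ⟨V, hV, fun R hR => ?_⟩
    by_contra! hcol
    obtain ⟨g, hg, hgP⟩ := H R hR fun u hu => by simpa using hcol u hu
    obtain ⟨v, hv, hv'⟩ := hPR _ (translate_mem_invExt hR (hΓ g hg))
    exact hv' (hgP v hv)

/-- There is an invariant type that all the tuples of any good list can simultaneously have. -/
theorem exists_universal (hne : (invExt L A).Nonempty) (c : ι → M) :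
    ∃ R ∈ invExt L A, ∀ l, Good L A c l → ∃ R' ∈ invExt L A, ∀ v ∈ l, typeAt R' v = typeAt R c := by
  classical
  have hclosed : IsClosed (invExt L A) := isClosed_invExtOn A _
  by_contra! hcon
  have h1 : ∀ R ∈ invExt L A, ∃ s ∈ typeAt R c, ∃ l, Good L A c l ∧
      ∀ R' ∈ invExt L A, ∃ v ∈ l, s ∉ typeAt R' v := by
    intro R hR
    obtain ⟨l, hl, hlR⟩ := hcon R hR
    by_contra! hall
    -- These closed sets are directed because `typeAt R c` is closed under intersection. A common
    -- point has the type `typeAt R c` at every entry of `l`.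
    let t : {s // s ∈ typeAt R c} → Set (Ultrafilter (M → M)) := fun s =>
      invExt L A ∩ ⋂ v ∈ l, {R' | (fun f => f ∘ v) ⁻¹' s.1 ∈ R'}
    have ht : ∀ s, IsClosed (t s) := fun s => hclosed.inter
      (isClosed_biInter fun v _ => ultrafilter_isClosed_basic _)
    have htne : ∀ s, (t s).Nonempty := fun s => by
      obtain ⟨R', hR', hs⟩ := hall s.1 s.2 l hl
      exact ⟨R', hR', Set.mem_iInter₂.2 hs⟩
    have : Nonempty {s // s ∈ typeAt R c} := ⟨⟨Set.univ, Filter.univ_mem⟩⟩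
    obtain ⟨R', hR'⟩ := IsCompact.nonempty_iInter_of_directed_nonempty_isCompact_isClosed t
      (by
        have hmono : ∀ s s' : {s // s ∈ typeAt R c}, s.1 ⊆ s'.1 → t s ⊆ t s' := by
          intro s s' hss
          refine Set.inter_subset_inter_right _ (Set.iInter₂_mono fun v _ R' hR' => ?_)
          exact Filter.mem_of_superset hR' (Set.preimage_mono hss)
        exact fun s s' => ⟨⟨s.1 ∩ s'.1, Filter.inter_mem s.2 s'.2⟩,
          hmono _ _ Set.inter_subset_left, hmono _ _ Set.inter_subset_right⟩)
      htne (fun s => (ht s).isCompact) ht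
    rw [Set.mem_iInter] at hR'
    obtain ⟨v, hv, hne⟩ := hlR R' (hR' ⟨Set.univ, Filter.univ_mem⟩).1
    refine hne ?_
    refine Ultrafilter.coe_le_coe.1 fun s hs => ?_
    have := (hR' ⟨s, hs⟩).2
    simp only [Set.mem_iInter] at this
    exact this v hv
  choose s hs l hl hlR using h1
  obtain ⟨t, ht⟩ := hclosed.isCompact.elim_finite_subcover
    (fun R : invExt L A => {R' : Ultrafilter (M → M) | (fun f => f ∘ c) ⁻¹' s R R.2 ∈ R'})
    (fun R => ultrafilter_isOpen_basic _) (fun R hR => Set.mem_iUnion.2 ⟨⟨R, hR⟩, hs R hR⟩)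
  obtain ⟨U, hU, hUJ⟩ := exists_finset_forall_notMem (L := L) (A := A) (c := c)
    (t.toList.map fun R : invExt L A => (s R R.2, l R R.2)) (by
      simp only [List.mem_map, forall_exists_index, and_imp, forall_apply_eq_imp_iff₂]
      exact fun R _ => ⟨hl _ _, hlR _ _⟩)
  obtain ⟨R, hR⟩ := hne
  obtain ⟨u, hu, huJ⟩ := hUJ R hR
  obtain ⟨g, hg, rfl⟩ := hU u hu
  -- The translate has at `c` the type that `R` has at `g • c`, and the cover forces that type to
  -- contain one of the sets it avoids.
  have := ht (translate_mem_invExt hR hg)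
  simp only [Set.mem_iUnion] at this
  obtain ⟨R', hR't, hR'⟩ := this
  exact huJ (s R' R'.2, l R' R'.2) (List.mem_map.2 ⟨R', by simpa using hR't, rfl⟩) hR'

end GoodLists

/-! ### Finite Morley sequences and their uniqueness up to conjugacy -/

section MorleyLists

variable {M : Type w} [L.Structure M] {ι : Type*}

variable (L) in
/-- Finite Morley sequences over `B` generated by `U`; the tuple realized last comes first. -/
def MorleyList (U : Ultrafilter (ι → M)) (B : Set M) : List (ι → M) → Prop
  | [] => True
  | v :: l => MorleyList U B l ∧ Realizes L U (B ∪ points l) v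

theorem points_map_smul (l : List (ι → M)) (g : Equiv.Perm M) :
    points (l.map (g • ·)) = g '' points l := by
  ext x
  constructor
  · rintro ⟨_, hgv, i, rfl⟩
    obtain ⟨v, hv, rfl⟩ := List.mem_map.1 hgv
    exact ⟨v i, mem_points hv i, rfl⟩
  · rintro ⟨_, ⟨v, hv, i, rfl⟩, rfl⟩
    exact mem_points (List.mem_map.2 ⟨v, hv, rfl⟩) i

theorem MorleyList.exists_map_eq [Nonempty M] [Finite ι] {κ : Cardinal.{w}} (hM : IsMonster L M κ)
    {A : Set M} (hA : #A < κ) {R : Ultrafilter (M → M)} (hR : R ∈ invExt L A) {c : ι → M}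
    {l l' : List (ι → M)} (hll : l.length = l'.length) (h : MorleyList L (typeAt R c) A l)
    (h' : MorleyList L (typeAt R c) A l') : ∃ g ∈ autFixing L A, l.map (g • ·) = l' := by
  induction l generalizing l' with
  | nil =>
    rw [List.length_nil, eq_comm, List.length_eq_zero_iff] at hll
    exact ⟨1, one_mem _, hll.symm⟩
  | cons v l ih =>
    cases l' with
    | nil => simp at hll
    | cons v' l' =>
      obtain ⟨g, hg, hgl⟩ := ih (by simpa using hll) h.1 h'.1
      have h1 := h.2.smul hR hg
      rw [Set.image_union, image_eq_of_mem_autFixing hg, ← points_map_smul, hgl] at h1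
      obtain ⟨k, hk, hkv⟩ := h1.exists_smul_eq hM (hM.mk_union_lt hA (finite_points l')) h'.2
      refine ⟨k * g, mul_mem (autFixing_mono Set.subset_union_left hk) hg, ?_⟩
      rw [List.map_cons, mul_smul, hkv]
      congr 1
      conv_rhs => rw [← List.map_id l', ← hgl, List.map_map]
      rw [← hgl] at hk
      refine List.map_congr_left fun w hw => ?_
      ext i
      exact hk.2 _ (Or.inr (mem_points (List.mem_map.2 ⟨w, hw, rfl⟩) i))

end MorleyLists

/-! ### Trees that are Morley along paths and along right-combs -/

section Trees

variable {M : Type w} [L.Structure M] {ι : Type*}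

/-- The nodes of height less than `n` of a tree of tuples. -/
def treeList : ℕ → (List Bool → ι → M) → List (ι → M)
  | 0, _ => []
  | n + 1, t => treeList n (fun σ => t (true :: σ)) ++ treeList n (fun σ => t (false :: σ)) ++ [t [] ]

theorem mem_treeList {n : ℕ} {t : List Bool → ι → M} {σ : List Bool} (h : σ.length < n) :
    t σ ∈ treeList n t := by
  induction n generalizing t σ with
  | zero => simp at h
  | succ n ih =>
    rcases σ with _ | ⟨_ | _, σ⟩
    · simp [treeList]
    · have := ih (t := fun σ => t (false :: σ)) (σ := σ) (by simpa using h)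
      simp [treeList, this]
    · have := ih (t := fun σ => t (true :: σ)) (σ := σ) (by simpa using h)
      simp [treeList, this]

theorem treeList_smul (n : ℕ) (t : List Bool → ι → M) (g : Equiv.Perm M) :
    treeList n (fun σ => g • t σ) = (treeList n t).map (g • ·) := by
  induction n generalizing t with
  | zero => rfl
  | succ n ih => simp [treeList, ih]

variable (L) in
/-- A tree in which every node realizes `Up` over the nodes above it, and every node realizes `Uq`
over the nodes that branch off from it to the right. -/
def CombTree (A : Set M) (Up Uq : Ultrafilter (ι → M)) : ℕ → (List Bool → ι → M) → Prop
  | 0, _ => True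
  | n + 1, t =>
    CombTree A Up Uq n (fun σ => t (true :: σ)) ∧ CombTree A Up Uq n (fun σ => t (false :: σ)) ∧
    (∀ σ, σ.length < n →
      Realizes L Uq (A ∪ points (treeList n fun σ => t (true :: σ))) (t (false :: σ))) ∧
    Realizes L Up (A ∪ points (treeList n (fun σ => t (true :: σ)) ++
      treeList n (fun σ => t (false :: σ)))) (t [])

variable {A : Set M} {Up Uq : Ultrafilter (ι → M)}

theorem CombTree.realizes_path {n : ℕ} {t : List Bool → ι → M} (h : CombTree L A Up Uq n t)
    {σ : List Bool} (hσ : σ.length < n) :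
    Realizes L Up (A ∪ {x | ∃ ρ, ρ ≠ [] ∧ (σ ++ ρ).length < n ∧ x ∈ Set.range (t (σ ++ ρ))})
      (t σ) := by
  induction n generalizing t σ with
  | zero => simp at hσ
  | succ n ih =>
    obtain ⟨hr, hl, -, hroot⟩ := h
    rcases σ with _ | ⟨_ | _, σ⟩
    · refine hroot.mono (Set.union_subset_union_right _ ?_)
      rintro x ⟨ρ, hρ, hlen, hx⟩
      rcases ρ with _ | ⟨_ | _, ρ⟩
      · exact absurd rfl hρ
      · exact ⟨_, List.mem_append_right _
          (mem_treeList (t := fun σ => t (false :: σ)) (σ := ρ) (by simpa using hlen)), hx⟩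
      · exact ⟨_, List.mem_append_left _
          (mem_treeList (t := fun σ => t (true :: σ)) (σ := ρ) (by simpa using hlen)), hx⟩
    · simpa using ih hl (σ := σ) (by simpa using hσ)
    · simpa using ih hr (σ := σ) (by simpa using hσ)

theorem CombTree.realizes_comb {n : ℕ} {t : List Bool → ι → M} (h : CombTree L A Up Uq n t)
    {σ τ : List Bool} (hσ : (σ ++ false :: τ).length < n) :
    Realizes L Uq (A ∪ {x | ∃ ρ, (σ ++ true :: ρ).length < n ∧ x ∈ Set.range (t (σ ++ true :: ρ))})
      (t (σ ++ false :: τ)) := by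
  induction n generalizing t σ with
  | zero => simp at hσ
  | succ n ih =>
    obtain ⟨hr, hl, hcomb, -⟩ := h
    rcases σ with _ | ⟨_ | _, σ⟩
    · refine (hcomb τ (by simpa using hσ)).mono (Set.union_subset_union_right _ ?_)
      rintro x ⟨ρ, hlen, hx⟩
      exact ⟨_, mem_treeList (t := fun σ => t (true :: σ)) (σ := ρ) (by simpa using hlen), hx⟩
    · simpa using ih hl (σ := σ) (by simpa [← Nat.add_assoc] using hσ)
    · simpa using ih hr (σ := σ) (by simpa [← Nat.add_assoc] using hσ)

theorem CombTree.morleyList_path {n : ℕ} {t : List Bool → ι → M} (h : CombTree L A Up Uq n t)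
    {S : List (List Bool)} (hS : S.Pairwise fun σ τ => ∃ ρ, ρ ≠ [] ∧ τ = σ ++ ρ)
    (hlen : ∀ σ ∈ S, σ.length < n) : MorleyList L Up A (S.map t) := by
  induction S with
  | nil => trivial
  | cons σ S ih =>
    rw [List.pairwise_cons] at hS
    refine ⟨ih hS.2 fun σ hσ => hlen σ (by simp [hσ]),
      (h.realizes_path (hlen σ (by simp))).mono (Set.union_subset_union_right _ ?_)⟩
    rintro x ⟨_, hv, hx⟩
    obtain ⟨τ, hτ, rfl⟩ := List.mem_map.1 hv
    obtain ⟨ρ, hρ, rfl⟩ := hS.1 τ hτ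
    exact ⟨ρ, hρ, hlen _ (by simp [hτ]), hx⟩

/-- In a comb splitting at `σ`, the single node to the left realizes `Uq` over the entire right
part, so it is put in front of the list obtained for the right part. -/
theorem CombTree.exists_morleyList_comb {n : ℕ} {t : List Bool → ι → M}
    (h : CombTree L A Up Uq n t) (hA : ∀ σ, σ.length < n → Realizes L Uq A (t σ))
    {X : Set (List Bool)} (hX : IsRightComb X) (s : Finset (List Bool)) (hs : (s : Set _) ⊆ X)
    (hlen : ∀ σ ∈ s, σ.length < n) :
    ∃ S : List (List Bool), (∀ σ, σ ∈ S ↔ σ ∈ s) ∧ MorleyList L Uq A (S.map t) := by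
  classical
  induction hX generalizing s with
  | subsingleton X hX =>
    rcases s.eq_empty_or_nonempty with rfl | ⟨σ, hσ⟩
    · exact ⟨[], by simp, trivial⟩
    · refine ⟨[σ], fun τ => ?_, trivial, ?_⟩
      · rw [List.mem_singleton]
        exact ⟨fun h => h ▸ hσ, fun h => hX (hs h) (hs hσ)⟩
      · simpa [points] using hA σ (hlen σ hσ)
  | step X σ hext hτ _ ih =>
    obtain ⟨τ₀, hτ₀⟩ := hτ
    obtain ⟨S, hS, hmor⟩ := ih (s.filter fun ρ => σ ++ [true] <+: ρ)
      (fun ρ hρ => by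
        rw [Finset.mem_coe, Finset.mem_filter] at hρ
        exact ⟨hs hρ.1, hρ.2⟩)
      (fun ρ hρ => hlen ρ (Finset.mem_filter.1 hρ).1)
    simp only [Finset.mem_filter] at hS
    have hcases : ∀ ρ ∈ s, ρ = τ₀ ∨ σ ++ [true] <+: ρ := by
      intro ρ hρ
      obtain ⟨⟨ρ', rfl⟩, hne⟩ := hext ρ (hs hρ)
      rcases ρ' with _ | ⟨_ | _, ρ'⟩
      · simp at hne
      · left
        have : σ ++ false :: ρ' ∈ ({τ₀} : Set (List Bool)) := by
          rw [← hτ₀]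
          exact ⟨hs hρ, ⟨ρ', by simp⟩⟩
        exact this
      · exact Or.inr ⟨ρ', by simp⟩
    by_cases hmem : τ₀ ∈ s
    · refine ⟨τ₀ :: S, fun ρ => ?_, hmor, ?_⟩
      · rw [List.mem_cons, hS]
        constructor
        · rintro (rfl | h)
          exacts [hmem, h.1]
        · exact fun hρ => (hcases ρ hρ).imp_right fun h => ⟨hρ, h⟩
      · have h0 : τ₀ ∈ X ∩ {ρ | σ ++ [false] <+: ρ} := by rw [hτ₀]; rfl
        obtain ⟨τ, rfl⟩ := h0.2
        have hlen0 := hlen _ hmem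
        rw [List.append_assoc] at hlen0 ⊢
        refine (h.realizes_comb hlen0).mono (Set.union_subset_union_right _ ?_)
        rintro x ⟨_, hv, hx⟩
        obtain ⟨ρ, hρ, rfl⟩ := List.mem_map.1 hv
        obtain ⟨hρs, ρ', rfl⟩ := (hS ρ).1 hρ
        have := hlen _ hρs
        rw [List.append_assoc] at this hx
        exact ⟨ρ', this, hx⟩
    · refine ⟨S, fun ρ => ?_, hmor⟩
      rw [hS]
      refine ⟨fun h => h.1, fun hρ => ⟨hρ, (hcases ρ hρ).resolve_left ?_⟩⟩
      rintro rfl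
      exact hmem hρ

theorem CombTree.smul [Finite ι] {Rp Rq : Ultrafilter (M → M)} (hRp : Rp ∈ invExt L A)
    (hRq : Rq ∈ invExt L A) {c : ι → M} {n : ℕ} {t : List Bool → ι → M}
    (h : CombTree L A (typeAt Rp c) (typeAt Rq c) n t) {g : Equiv.Perm M} (hg : g ∈ autFixing L A) :
    CombTree L A (typeAt Rp c) (typeAt Rq c) n fun σ => g • t σ := by
  induction n generalizing t with
  | zero => trivial
  | succ n ih =>
    obtain ⟨h1, h2, h3, h4⟩ := h
    refine ⟨ih h1, ih h2, fun σ hσ => ?_, ?_⟩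
    · have := (h3 σ hσ).smul hRq hg
      rwa [Set.image_union, image_eq_of_mem_autFixing hg, ← points_map_smul, ← treeList_smul] at this
    · have := h4.smul hRp hg
      rwa [Set.image_union, image_eq_of_mem_autFixing hg, ← points_map_smul, List.map_append,
        ← treeList_smul, ← treeList_smul] at this

theorem Good.exists_smul_eq {c : ι → M} {l : List (ι → M)} (hl : Good L A c l) {v : ι → M}
    (hv : v ∈ l) : ∃ g ∈ autFixing L A, g • c = v := by
  induction l with
  | nil => simp at hv
  | cons w l ih =>
    rcases List.mem_cons.1 hv with rfl | hv
    exacts [hl.2.1, ih hl.1 hv]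

theorem realizes_smul [Finite ι] {R : Ultrafilter (M → M)} (hR : R ∈ invExt L A) {c : ι → M}
    {g : Equiv.Perm M} (hg : g ∈ autFixing L A) : Realizes L (typeAt R c) A (g • c) := by
  intro s hs hU
  refine (comp_mem_iff hg hs).2 ?_
  by_contra hc
  exact Ultrafilter.compl_mem_iff_notMem.1 (mem_typeAt_of_definable hR hs.compl hc) hU

/-- Goodness is carried along because it is what lets universality supply one `R'` for all nodes of
the left copy. `Good.append` preserves it when the copy and then the root are added. -/
theorem exists_combTree [Nonempty M] [Finite ι] {κ : Cardinal.{w}} (hM : IsMonster L M κ)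
    (hA : #A < κ) {Rp Rq : Ultrafilter (M → M)} (hRp : Rp ∈ invExt L A) (hRq : Rq ∈ invExt L A)
    {c : ι → M} (huniv : ∀ l, Good L A c l →
      ∃ R' ∈ invExt L A, ∀ v ∈ l, typeAt R' v = typeAt Rq c) (n : ℕ) :
    ∃ t : List Bool → ι → M, CombTree L A (typeAt Rp c) (typeAt Rq c) n t ∧
      Good L A c (treeList n t) := by
  induction n with
  | zero => exact ⟨fun _ => c, trivial, trivial⟩
  | succ n ih =>
    obtain ⟨t, ht, hgood⟩ := ih
    obtain ⟨R', hR', hR'q⟩ := huniv _ hgood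
    obtain ⟨g, hg, hgen⟩ := exists_isGeneric hM hA hR'
      (hM.mk_union_lt hA (finite_points (treeList n t))) Set.subset_union_left
      (finite_points (treeList n t))
    have hgood2 := hgood.append hM hA hR' (hgood.map hg) hgen
    obtain ⟨h, hh, hhgen⟩ := exists_isGeneric hM hA hRp
      (hM.mk_union_lt hA (finite_points (treeList n t ++ (treeList n t).map (g • ·))))
      Set.subset_union_left (finite_points [c])
    refine ⟨fun σ => match σ with
      | [] => h • c
      | true :: σ => t σ
      | false :: σ => g • t σ, ⟨ht, ht.smul hRp hRq hg, fun σ hσ => ?_, ?_⟩, ?_⟩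
    · have hmem := mem_treeList (t := t) hσ
      rw [← hR'q _ hmem]
      exact hgen.realizes fun i => mem_points hmem i
    · simp only [treeList_smul]
      exact hhgen.realizes fun i => mem_points (by simp) i
    · simp only [treeList, treeList_smul]
      exact hgood2.append hM hA hRp (l₂ := [c]) (good_singleton ⟨h, hh, rfl⟩) hhgen

end Trees

/-! ### From finite trees to the comb tree property -/

section CombTreeProperty

/-- The ultrapower satisfies the required formulas, but may live in another universe. Its type is
realized again in a model in the universe that `HasKCTP` asks for. -/
theorem exists_modelType_of_ultrafilter {T : L.Theory} {M : Type w} [L.Structure M] [Nonempty M]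
    [M ⊨ T] {α : Type} (U : Ultrafilter (α → M)) :
    ∃ (N : Theory.ModelType.{u, v, max u v} T) (x : α → N),
      ∀ φ : L.Formula α, φ.Realize x ↔ {y : α → M | φ.Realize y} ∈ U := by
  let N := (U : Filter (α → M)).Product fun _ => M
  have hmod : N ⊨ T := by
    refine ⟨fun φ hφ => ?_⟩
    rw [Ultraproduct.sentence_realize]
    exact Filter.Eventually.of_forall fun _ => Theory.realize_sentence_of_mem T hφ
  let x : α → (α → M) → M := fun i v => v i
  let y : α → N := fun i =>
    (Quotient.mk _ (x i) : Quotient (Filter.productSetoid (U : Filter (α → M)) _))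
  obtain ⟨K, z, hz⟩ := Theory.exists_modelType_is_realized_in T (T.typeOf y)
  refine ⟨K, z, fun φ => ?_⟩
  rw [← Theory.CompleteType.formula_mem_typeOf (T := T), hz,
    Theory.CompleteType.formula_mem_typeOf]
  exact Ultraproduct.realize_formula_cast φ x

/-- The formula saying that finitely many instances of `ψ` are jointly consistent. -/
noncomputable def consistencyFormula {β ι J : Type} [Finite β] (ψ : L.Formula (β ⊕ ι))
    (s : Finset J) : L.Formula (J × ι) :=
  Formula.iExs β (Formula.iInf fun j : s =>
    ψ.relabel (Sum.elim Sum.inr fun i => Sum.inl ((j : J), i)))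

theorem realize_consistencyFormula {β ι J : Type} [Finite β] {ψ : L.Formula (β ⊕ ι)}
    {s : Finset J} {N : Type*} [L.Structure N] {x : J × ι → N} :
    (consistencyFormula ψ s).Realize x ↔
      ∃ a : β → N, ∀ j ∈ s, ψ.Realize (Sum.elim a fun i => x (j, i)) := by
  simp only [consistencyFormula, Formula.realize_iExs, Formula.realize_iInf,
    Formula.realize_relabel, Subtype.forall, Sum.comp_elim, Sum.elim_comp_inr]
  rfl

variable {M : Type w} [L.Structure M] [Nonempty M] {κ : Cardinal.{w}} {A : Set M}

theorem hasCTP_of_universal {T : L.Theory} [M ⊨ T] (hM : IsMonster L M κ) (hA : #A < κ)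
    {Rp Rq : Ultrafilter (M → M)} (hRp : Rp ∈ invExt L A) (hRq : Rq ∈ invExt L A) {N d : ℕ}
    {c : Fin N → M} (huniv : ∀ l, Good L A c l →
      ∃ R' ∈ invExt L A, ∀ v ∈ l, typeAt R' v = typeAt Rq c) {ψ : L.Formula (Fin d ⊕ Fin N)} {k : ℕ}
    (hp : ∀ l, l.length = k → MorleyList L (typeAt Rp c) A l →
      ¬ ∃ a : Fin d → M, ∀ v ∈ l, ψ.Realize (Sum.elim a v))
    (hq : ∀ l, MorleyList L (typeAt Rq c) A l →
      ∃ a : Fin d → M, ∀ v ∈ l, ψ.Realize (Sum.elim a v)) : HasCTP T := by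
  classical
  choose t ht hgood using exists_combTree hM hA hRp hRq huniv
  -- A nonprincipal limit of the trees of height `n` gives an infinite tree. Any finite set of nodes
  -- lies below height `n` for almost all `n`.
  obtain ⟨K, x, hx⟩ := exists_modelType_of_ultrafilter (T := T)
    ((Filter.hyperfilter ℕ).map fun n (p : List Bool × Fin N) => t n p.1 p.2)
  have hfin : ∀ s : Finset (List Bool), ∃ n₀, ∀ n, n₀ < n → ∀ σ ∈ s, σ.length < n := fun s =>
    ⟨s.sup List.length, fun n hn σ hσ => (Finset.le_sup (f := List.length) hσ).trans_lt hn⟩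
  have hlarge : ∀ n₀ : ℕ, {n | n₀ < n} ∈ Filter.hyperfilter ℕ := fun n₀ => by
    have := (Set.finite_Iic n₀).compl_mem_hyperfilter
    exact Filter.mem_of_superset this fun n hn => by simpa using hn
  refine ⟨k, K, d, N, ψ, fun σ i => x (σ, i), fun α s hs hcon => ?_, fun X hX s hsX => ?_⟩
  · let path : ℕ → List Bool := fun n => (List.range n).map α
    obtain ⟨a, ha⟩ := hcon s subset_rfl
    have h1 : (consistencyFormula ψ (s.image path)).Realize x := by
      rw [realize_consistencyFormula]
      refine ⟨a, fun σ hσ => ?_⟩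
      obtain ⟨i, hi, rfl⟩ := Finset.mem_image.1 hσ
      exact ha i hi
    rw [hx, Ultrafilter.mem_map] at h1
    obtain ⟨n₀, hn₀⟩ := hfin (s.image path)
    obtain ⟨n, hn1, hn2⟩ := (Filter.hyperfilter ℕ).nonempty_of_mem
      (Filter.inter_mem h1 (hlarge n₀))
    obtain ⟨a', ha'⟩ := realize_consistencyFormula.1 hn1
    -- Nodes on a path are realized from the longest to the shortest, so increasing order puts the
    -- tuple realized last in front.
    refine hp (((s.sort (· ≤ ·)).map path).map (t n)) (by simpa using hs)
      ((ht n).morleyList_path ?_ fun σ hσ => hn₀ n hn2 σ (by simpa using hσ)) ⟨a', ?_⟩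
    · rw [List.pairwise_map]
      refine (Finset.sortedLT_sort s).pairwise.imp fun {i j} hij => ?_
      obtain ⟨m, rfl⟩ := Nat.exists_eq_add_of_lt hij
      refine ⟨(List.range (m + 1)).map fun r => α (i + r), by simp, ?_⟩
      simp only [path]
      rw [Nat.add_assoc, List.range_add, List.map_append, List.map_map]
      rfl
    · simp only [List.map_map, List.mem_map, Finset.mem_sort, Function.comp_apply,
        forall_exists_index, and_imp, forall_apply_eq_imp_iff₂]
      exact fun i hi => ha' (path i) (Finset.mem_image_of_mem _ hi)
  · refine realize_consistencyFormula.1 ((hx _).2 ?_)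
    obtain ⟨n₀, hn₀⟩ := hfin s
    rw [Ultrafilter.mem_map]
    refine Filter.mem_of_superset (hlarge n₀) fun n hn => ?_
    refine realize_consistencyFormula.2 ?_
    obtain ⟨S, hS, hmor⟩ := (ht n).exists_morleyList_comb (fun σ hσ => by
      obtain ⟨g, hg, hgc⟩ := (hgood n).exists_smul_eq (mem_treeList hσ)
      rw [← hgc]
      exact realizes_smul hRq hg) hX s hsX (hn₀ n hn)
    obtain ⟨a, ha⟩ := hq _ hmor
    exact ⟨a, fun σ hσ => ha _ (List.mem_map.2 ⟨σ, (hS σ).2 hσ, rfl⟩)⟩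

end CombTreeProperty

/-! ### Infinite Morley sequences and transfer of inconsistency -/

section MorleySequences

variable {M : Type w} [L.Structure M] {ι : Type*}

theorem morleyList_map_of_sequence {U : Ultrafilter (ι → M)} {B : Set M} {f : ℕ → ι → M}
    (hf : ∀ i, Realizes L U (B ∪ ⋃ j < i, Set.range (f j)) (f i)) {S : List ℕ}
    (hS : S.Pairwise (· > ·)) : MorleyList L U B (S.map f) := by
  induction S with
  | nil => trivial
  | cons i S ih =>
    rw [List.pairwise_cons] at hS
    refine ⟨ih hS.2, (hf i).mono (Set.union_subset_union_right _ ?_)⟩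
    rintro x ⟨_, hv, hx⟩
    obtain ⟨j, hj, rfl⟩ := List.mem_map.1 hv
    exact Set.mem_iUnion₂.2 ⟨j, hS.1 j hj, hx⟩

theorem pairwise_reverse_sort (s : Finset ℕ) : ((s.sort (· ≤ ·)).reverse).Pairwise (· > ·) :=
  List.pairwise_reverse.2 (Finset.sortedLT_sort s).pairwise

theorem MorleyList.comp_right {R : Ultrafilter (M → M)} {c : ι → M} {B : Set M}
    {l : List (ι → M)} (h : MorleyList L (typeAt R c) B l) {ι' : Type*} (j : ι' → ι) :
    MorleyList L (typeAt R (c ∘ j)) B (l.map (· ∘ j)) := by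
  induction l with
  | nil => trivial
  | cons v l ih =>
    refine ⟨ih h.1, (h.2.comp_right j).mono (Set.union_subset_union_right _ ?_)⟩
    rintro x ⟨_, hv, i, rfl⟩
    obtain ⟨w, hw, rfl⟩ := List.mem_map.1 hv
    exact mem_points hw (j i)

variable [Nonempty M] {κ : Cardinal.{w}} {A : Set M} {R : Ultrafilter (M → M)} {c : ι → M}

theorem exists_morley_sequence {ι : Type} [Finite ι] (hM : IsMonster L M κ)
    (U : Ultrafilter (ι → M)) {B : Set M} (hB : #B < κ) :
    ∃ f : ℕ → ι → M, ∀ i, Realizes L U (B ∪ ⋃ j < i, Set.range (f j)) (f i) := by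
  choose G hG using fun l : List (ι → M) =>
    hM.exists_realization U (hM.mk_union_lt hB (finite_points l))
  let l : ℕ → List (ι → M) := fun n => n.rec [] fun _ l => G l :: l
  have hl : ∀ i j, j < i → G (l j) ∈ l i := by
    intro i j hj
    induction i with
    | zero => simp at hj
    | succ i ih =>
      rcases Nat.lt_succ_iff_lt_or_eq.1 hj with h | rfl
      · exact List.mem_cons_of_mem _ (ih h)
      · exact List.mem_cons_self
  refine ⟨fun i => G (l i), fun i => Realizes.mono (hG (l i)) (Set.union_subset_union_right _ ?_)⟩
  intro x hx
  obtain ⟨j, hj, hx⟩ := Set.mem_iUnion₂.1 hx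
  exact ⟨_, hl i j hj, hx⟩

theorem not_consistent_of_morleyList [Finite ι] (hM : IsMonster L M κ) (hA : #A < κ)
    (hR : R ∈ invExt L A) {β : Type} {ψ : L.Formula (β ⊕ ι)} {l l' : List (ι → M)}
    (hll : l.length = l'.length) (h : MorleyList L (typeAt R c) A l)
    (h' : MorleyList L (typeAt R c) A l')
    (hbad : ¬ ∃ a : β → M, ∀ v ∈ l, ψ.Realize (Sum.elim a v)) :
    ¬ ∃ a : β → M, ∀ v ∈ l', ψ.Realize (Sum.elim a v) := by
  obtain ⟨g, hg, rfl⟩ := h.exists_map_eq hM hA hR hll h'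
  rintro ⟨a, ha⟩
  refine hbad ⟨g⁻¹ • a, fun v hv => ?_⟩
  rw [← realize_comp_of_mem_autFixing hg, Sum.comp_elim]
  have := ha _ (List.mem_map_of_mem hv)
  rwa [← smul_inv_smul g a] at this

end MorleySequences

/-! ### Kim-forking implies Kim-dividing -/

section KimForkingAndDividing

variable {M : Type w} [L.Structure M] [Nonempty M] {κ : Cardinal.{w}} {A : Set M}

/-- Kim-dividing is witnessed by all Morley lists of some fixed length. -/
theorem KimDivides.exists_length (hM : IsMonster L M κ) (hA : #A < κ) {α β : Type} [Finite β]
    {ψ : L.Formula (α ⊕ β)} {c : β → M} (h : KimDivides A ψ c) :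
    ∃ R ∈ invExt L A, ∃ k : ℕ, ∀ l, l.length = k → MorleyList L (typeAt R c) A l →
      ¬ ∃ a : α → M, ∀ v ∈ l, ψ.Realize (Sum.elim a v) := by
  obtain ⟨p, hp, hpc, e, he, hcon⟩ := h
  obtain ⟨R, hR, hRp⟩ := hp.exists_mem_invExt hpc
  simp only [IsConsistent, not_forall] at hcon
  obtain ⟨s, -, hs⟩ := hcon
  refine ⟨R, hR, s.card, fun l hl hmor => ?_⟩
  have he' : ∀ i, Realizes L (typeAt R c) (A ∪ ⋃ j < i, Set.range (e j)) (e i) := fun i =>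
    (hRp.realizesOver_iff _).1 (he i)
  refine not_consistent_of_morleyList hM hA hR (by simpa using hl.symm)
    (morleyList_map_of_sequence he' (pairwise_reverse_sort s)) hmor ?_
  rintro ⟨a, ha⟩
  exact hs ⟨a, fun i hi => ha _ (List.mem_map_of_mem (by simpa using hi))⟩

theorem KimDivides.kimForks {α : Type} {m : ℕ} {φ : L.Formula (α ⊕ Fin m)} {b : Fin m → M}
    (h : KimDivides A φ b) : KimForks A φ b :=
  ⟨1, fun _ => m, fun _ => φ, fun _ => b, fun _ ha => ⟨0, ha⟩, fun _ => h⟩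

theorem KimForks.kimDivides {T : L.Theory} [M ⊨ T] (hT : ¬ HasCTP T) (hM : IsMonster L M κ)
    (hA : #A < κ) (hbase : IsInvarianceBase L A) {d m : ℕ} {φ : L.Formula (Fin d ⊕ Fin m)}
    {b : Fin m → M} (h : KimForks A φ b) : KimDivides A φ b := by
  classical
  obtain ⟨n, m', ψ, c', himp, hdiv⟩ := h
  obtain ⟨N, ⟨e⟩⟩ := Finite.exists_equiv_fin (Fin m ⊕ Σ i, Fin (m' i))
  let c : Fin N → M := Sum.elim b (fun p => c' p.1 p.2) ∘ e.symm
  let jb : Fin m → Fin N := fun i => e (Sum.inl i)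
  let jc : ∀ i, Fin (m' i) → Fin N := fun i r => e (Sum.inr ⟨i, r⟩)
  have hjb : c ∘ jb = b := by ext i; simp [c, jb]
  have hjc : ∀ i, c ∘ jc i = c' i := fun i => by ext r; simp [c, jc]
  obtain ⟨R, hR, huniv⟩ := exists_universal hbase.invExt_nonempty c
  have hbad : ∀ i, ∃ k : ℕ, ∀ l, l.length = k → MorleyList L (typeAt R c) A l →
      ¬ ∃ a : Fin d → M, ∀ v ∈ l, (ψ i).Realize (Sum.elim a (v ∘ jc i)) := by
    -- If the universal type did not witness Kim-dividing of `ψ i`, some Morley list of each length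
    -- would be consistent, hence by conjugacy all of them. With inconsistency along `Rp` this gives
    -- CTP.
    intro i
    obtain ⟨Rp, hRp, k, hk⟩ := (hdiv i).exists_length hM hA
    let ψ' : L.Formula (Fin d ⊕ Fin N) := (ψ i).relabel (Sum.map id (jc i))
    have hψ' : ∀ (a : Fin d → M) (v : Fin N → M),
        ψ'.Realize (Sum.elim a v) ↔ (ψ i).Realize (Sum.elim a (v ∘ jc i)) := fun a v => by
      simp only [ψ', Formula.realize_relabel, Sum.elim_comp_map, Function.comp_id]
    by_contra! hcon
    refine hT (hasCTP_of_universal hM hA hRp hR huniv (ψ := ψ') (k := k) ?_ ?_)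
    · rintro l hl hmor ⟨a, ha⟩
      have := hmor.comp_right (jc i)
      rw [hjc] at this
      refine hk _ (by simpa using hl) this ⟨a, ?_⟩
      simpa [hψ'] using ha
    · intro l hl
      by_contra hl'
      obtain ⟨l', hll', hmor, a, ha⟩ := hcon l.length
      exact not_consistent_of_morleyList hM hA hR hll'.symm hl hmor hl' ⟨a, by simpa [hψ'] using ha⟩
  choose k hk using hbad
  obtain ⟨f, hf⟩ := exists_morley_sequence hM (typeAt R c) hA
  obtain ⟨p, hp⟩ := exists_represented (L := L) (typeAt R b)
  refine ⟨p, isExtendiblyInvariant_of_represents hM hA hR hp, extends_of_represents hR hp,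
    fun i => f i ∘ jb, fun i => (hp.realizesOver_iff _).2 ?_, fun hcon => ?_⟩
  · rw [← hjb]
    refine ((hf i).comp_right jb).mono (Set.union_subset_union_right _ ?_)
    exact Set.iUnion₂_mono fun j _ => Set.range_comp_subset_range jb (f j)
  -- With this many instances satisfied by `a`, one of the `n` disjuncts holds at more than
  -- `Finset.univ.sup k` indices, enough to contradict its own bound `k j`.
  · obtain ⟨a, ha⟩ := hcon (Finset.range (n * Finset.univ.sup k + 1)) (Set.subset_univ _)
    have hcol : ∀ i ∈ Finset.range (n * Finset.univ.sup k + 1), ∃ j : Fin n,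
        (ψ j).Realize (Sum.elim a (f i ∘ jc j)) := by
      intro i hi
      -- `f i` is conjugate to `c` over `A`, so the implication from `φ` to the disjunction holds
      -- with the corresponding parts of `f i` as parameters.
      obtain ⟨g, hg, hgc⟩ := hM.exists_autFixing hA (c := c) (c' := f i) fun s hs hcs =>
        (hf i).mono Set.subset_union_left s hs (mem_typeAt_of_definable hR hs hcs)
      have h1 := ha i hi
      rw [← realize_comp_of_mem_autFixing (inv_mem hg), Sum.comp_elim] at h1
      have h2 : ∀ {q : ℕ} (j : Fin q → Fin N), ⇑g⁻¹ ∘ f i ∘ j = c ∘ j := fun j => by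
        ext r
        simp [← hgc]
      rw [h2, hjb] at h1
      obtain ⟨j, hj⟩ := himp _ h1
      refine ⟨j, ?_⟩
      rw [← realize_comp_of_mem_autFixing (inv_mem hg), Sum.comp_elim, h2, hjc]
      exact hj
    have : Nonempty (Fin n) := ⟨(hcol 0 (by simp)).choose⟩
    choose! col hcol using hcol
    obtain ⟨j, -, hj⟩ := Finset.exists_lt_card_fiber_of_mul_lt_card_of_maps_to
      (s := Finset.range (n * Finset.univ.sup k + 1)) (t := Finset.univ) (f := col)
      (n := Finset.univ.sup k) (fun _ _ => Finset.mem_univ _) (by simp)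
    obtain ⟨s, hs, hsk⟩ := Finset.exists_subset_card_eq
      ((Finset.le_sup (f := k) (Finset.mem_univ j)).trans hj.le)
    refine hk j _ (by simpa using hsk) (morleyList_map_of_sequence hf (pairwise_reverse_sort s))
      ⟨a, ?_⟩
    simp only [List.mem_map, List.mem_reverse, Finset.mem_sort, forall_exists_index, and_imp,
      forall_apply_eq_imp_iff₂]
    intro i hi
    obtain ⟨hi1, rfl⟩ := Finset.mem_filter.1 (hs hi)
    exact hcol i hi1

end KimForkingAndDividing
end KimForking

theorem mainTheorem5 {L : FirstOrder.Language.{u, v}} (T : L.Theory)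
    (hT : ¬ KimForking.HasCTP T)
    (M : Type w) [L.Structure M] [Nonempty M] [M ⊨ T] (κ : Cardinal.{w})
    (hM : KimForking.IsMonster L M κ)
    (A : Set M) (hA : Cardinal.mk A < κ) (hbase : KimForking.IsInvarianceBase L A)
    (k m : ℕ) (φ : L.Formula (Fin k ⊕ Fin m)) (b : Fin m → M) :
    KimForking.KimForks A φ b ↔ KimForking.KimDivides A φ b :=
  ⟨fun h => h.kimDivides hT hM hA hbase, fun h => h.kimForks⟩
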